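/- Consider the linear time-invariant system $$X(t+1)=AX(t)+V(t)\in\mathbb{R}^{n_x},\qquad Y(t)=CX(t)+W(t)\in\mathbb{R}^{n_y},\qquad t=0,1,2,\dots,$$ where $(C,A)$ is observable and $A$ has at least one eigenvalue of magnitude greater than one. *Channel.* A finite-state uncertain channel has a finite input alphabet $\mathcal X$ with $q=|\mathcal X|$, an output alphabet $\mathcal Y$, a finite nonempty state set $\mathcal S$ and, for each $s\in\mathcal S$, $x\in\mathcal X$, a nonempty set $T(s,x)\subseteq\mathcal Y\times\mathcal S$: if the channel is in state $s(t)$ and its input is $x(t)$, then the pair (output, next state) can be any element of $T(s(t),x(t))$, irrespective of the past; the initial state $s(0)\in\mathcal S$ is arbitrary and unknown. A zero-error code of length $n+1$ is a set $\mathcal F\subseteq\mathcal X^{n+1}$ such that no two distinct elements of $\mathcal F$ can result in the same output block, for any initial states and any channel behaviour. All logarithms are in base $q$, and the zero-error capacity is $C_0=\sup \frac{\log|\mathcal F|}{n+1}$ over all $n\ge 0$ and all zero-error codes $\mathcal F$ of length $n+1$. *Coder-estimator.* A coder-estimator consists of maps giving the channel input $D(t)=\zeta(t,Y(0),\dots,Y(t))\in\mathcal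 X$ and, from the channel outputs $Q(0),Q(1),\dots$, the estimates $\hat X(0)=0$, $\hat X(t+1)=\eta(t,Q(0),\dots,Q(t))\in\mathbb{R}^{n_x}$. It yields uniformly bounded estimation errors if for any uniformly bounded sets $\mathcal V$, $\mathcal W$ of noise signals $V$, $W$, each containing the zero signal, there is $l>0$ such that for every set $\mathcal I\subseteq\{x:\|x\|\le l\}$ of initial conditions $$\sup\|\hat X(t)-X(t)\|<\infty,$$ where the supremum is over all $t\ge 0$, all $X(0)\in\mathcal I$, $V\in\mathcal V$, $W\in\mathcal W$ (in any combination) and all possible channel responses to the resulting inputs. **Theorem.** Let $$h_{lin}=\sum_{|\lambda_i|\ge 1}\log|\lambda_i|,$$ the sum being over the eigenvalues $\lambda_i$ of $A$ counted with algebraic multiplicity, and suppose that $C_0>0$. If there exists a coder-estimator that yields uniformly bounded estimation errors, then $C_0\ge h_{lin}$. Conversely, if $C_0>h_{lin}$, then there exists a coder-estimator that yields uniformly bounded estimation errors. -/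

import Mathlib

namespace BoundedEstimation

/-! ### Finite-state uncertain channels and zero-error capacity -/

/-- A (time-invariant) finite-state uncertain channel with input alphabet `X`, output alphabet `Y`
and state set `S` (finite and nonempty where the channel is used).
`trans s x y s'` says that `(y, s')` lies in the conditional range
`⟦Y(t), S(t+1) | x(t) = x, s(t) = s⟧`; every input symbol may be sent in every state, so this range
is nonempty. -/
structure FiniteStateChannel (X Y S : Type*) where
  trans : S → X → Y → S → Prop
  range_nonempty : ∀ s x, ∃ y s', trans s x y s'

namespace FiniteStateChannel

variable {X Y S : Type*}

/-- The output block `y` can result from the input block `x`, for some initial state and some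
channel noise. -/
def CanOutput (ch : FiniteStateChannel X Y S) {m : ℕ} (x : Fin m → X) (y : Fin m → Y) : Prop :=
  ∃ s : Fin (m + 1) → S, ∀ i : Fin m, ch.trans (s i.castSucc) (x i) (y i) (s i.succ)

/-- The infinite output sequence `y` can result from the infinite input sequence `x`, for some
initial state and some channel noise. -/
def CanOutputSeq (ch : FiniteStateChannel X Y S) (x : ℕ → X) (y : ℕ → Y) : Prop :=
  ∃ s : ℕ → S, ∀ t, ch.trans (s t) (x t) (y t) (s (t + 1))

/-- A zero-error code: two distinct codewords can never result in the same output block,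
regardless of channel noise and initial states. -/
def IsZeroErrorCode (ch : FiniteStateChannel X Y S) {m : ℕ} (F : Finset (Fin m → X)) : Prop :=
  ∀ x ∈ F, ∀ x' ∈ F, x ≠ x' → ∀ y : Fin m → Y, ¬ (ch.CanOutput x y ∧ ch.CanOutput x' y)

/-- The zero-error capacity `C₀ = sup log_q |F| / (n + 1)`, over all `n ≥ 0` and all zero-error
codes `F` of length `n + 1`, where `q = |X|`. -/
noncomputable def zeroErrorCapacity [Fintype X] (ch : FiniteStateChannel X Y S) : ℝ :=
  sSup {r : ℝ | ∃ (n : ℕ) (F : Finset (Fin (n + 1) → X)), ch.IsZeroErrorCode F ∧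
    r = Real.logb (Fintype.card X) (F.card : ℝ) / ((n : ℝ) + 1)}

end FiniteStateChannel

/-! ### The linear system -/

variable {nx ny : ℕ}

/-- The pair `(C, A)` is observable: without disturbances, the initial state is determined by the
output sequence `C A ^ k x`, `k ≥ 0`. -/
def IsObservable (C : Matrix (Fin ny) (Fin nx) ℝ) (A : Matrix (Fin nx) (Fin nx) ℝ) : Prop :=
  Function.Injective fun (x : Fin nx → ℝ) (k : ℕ) => C.mulVec ((A ^ k).mulVec x)

/-- The complex eigenvalues of the real matrix `A`, with algebraic multiplicity. -/
noncomputable def eigenvalues (A : Matrix (Fin nx) (Fin nx) ℝ) : Multiset ℂ :=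
  (A.map (algebraMap ℝ ℂ)).charpoly.roots

/-- The topological entropy `∑_{|λᵢ| ≥ 1} log_q |λᵢ|` of the linear system. -/
noncomputable def linEntropy (q : ℕ) (A : Matrix (Fin nx) (Fin nx) ℝ) : ℝ :=
  (((eigenvalues A).filter fun z => 1 ≤ ‖z‖).map fun z => Real.logb q ‖z‖).sum

/-- The state `X(t)` of `X(t+1) = A X(t) + V(t)`. -/
def plantState (A : Matrix (Fin nx) (Fin nx) ℝ) (x₀ : Fin nx → ℝ) (v : ℕ → Fin nx → ℝ) :
    ℕ → Fin nx → ℝ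
  | 0 => x₀
  | t + 1 => A.mulVec (plantState A x₀ v t) + v t

/-- The output `Y(t) = C X(t) + W(t)`. -/
def plantOutput (A : Matrix (Fin nx) (Fin nx) ℝ) (C : Matrix (Fin ny) (Fin nx) ℝ)
    (x₀ : Fin nx → ℝ) (v : ℕ → Fin nx → ℝ) (w : ℕ → Fin ny → ℝ) (t : ℕ) : Fin ny → ℝ :=
  C.mulVec (plantState A x₀ v t) + w t

/-- A range of a noise signal (a set of signals) that is uniformly bounded and contains the zero
signal. -/
def IsAdmissibleNoise {n : ℕ} (N : Set (ℕ → Fin n → ℝ)) : Prop :=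
  (∃ b : ℝ, ∀ v ∈ N, ∀ t, ‖v t‖ ≤ b) ∧ 0 ∈ N

/-! ### Coder-estimators -/

/-- A causal coder `D(t) = ζ(t, Y(0:t))` and a causal estimator `X̂(t+1) = η(t, Q(0:t))`. -/
structure CoderEstimator (nx ny : ℕ) (X Y : Type*) where
  coder : (t : ℕ) → (Fin (t + 1) → Fin ny → ℝ) → X
  estimator : (t : ℕ) → (Fin (t + 1) → Y) → Fin nx → ℝ

namespace CoderEstimator

variable {X Y S : Type*}

/-- The channel inputs `D(t)` produced from the plant outputs. -/
def input (K : CoderEstimator nx ny X Y) (y : ℕ → Fin ny → ℝ) (t : ℕ) : X :=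
  K.coder t fun i => y i

/-- The state estimates `X̂(t)` produced from the channel outputs, with `X̂(0) = 0`. -/
def estimate (K : CoderEstimator nx ny X Y) (r : ℕ → Y) : ℕ → Fin nx → ℝ
  | 0 => 0
  | t + 1 => K.estimator t fun i => r i

/-- Uniformly bounded estimation errors: for all admissible noise ranges `NV`, `NW` there is
`l > 0` such that for every range `I` of initial conditions in the `l`-ball, the estimation error
is bounded, uniformly over all times and all valid realizations. As the initial condition, the two
noise signals and the channel errors are mutually unrelated, a valid realization is an arbitrary
combination of an initial condition in `I`, noise signals in `NV` and `NW`, and a possible response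
of the channel to the resulting input. -/
def UniformlyBoundedErrors (K : CoderEstimator nx ny X Y) (A : Matrix (Fin nx) (Fin nx) ℝ)
    (C : Matrix (Fin ny) (Fin nx) ℝ) (ch : FiniteStateChannel X Y S) : Prop :=
  ∀ (NV : Set (ℕ → Fin nx → ℝ)) (NW : Set (ℕ → Fin ny → ℝ)),
    IsAdmissibleNoise NV → IsAdmissibleNoise NW →
    ∃ l : ℝ, 0 < l ∧ ∀ I : Set (Fin nx → ℝ), I ⊆ Metric.closedBall 0 l →
      ∃ β : ℝ, ∀ x₀ ∈ I, ∀ v ∈ NV, ∀ w ∈ NW, ∀ r : ℕ → Y,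
        ch.CanOutputSeq (K.input (plantOutput A C x₀ v w)) r →
          ∀ t, ‖K.estimate r t - plantState A x₀ v t‖ ≤ β

end CoderEstimator

end BoundedEstimation

open BoundedEstimation

/-!
Up to a linear change of coordinates, `A` is the direct sum of a matrix whose eigenvalues satisfy
`1 ≤ |λ|` and one whose eigenvalues satisfy `|λ| < 1`; the entropy of `A` is the logarithm of the
absolute value of the determinant of the unstable block.

Necessity: `n` steps of the unstable dynamics multiply volumes by the `n`-th power of this
determinant, so of that order many small initial states are separated after `n` steps by more than
twice the error bound. The coder then has to send them as the words of a zero-error code.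

Sufficiency: by observability, the last few outputs determine the current state up to a bounded
error. The stable coordinates stay bounded and need no information. The unstable ones are sampled
every `n` steps, for a large `n`, and tracked by an adaptive quantizer which, by a volume count,
needs fewer messages than there are concatenations of zero-error codewords of total length `n`.
Its scale grows with every overflow, and only finitely many overflows can occur.
-/

namespace BoundedEstimation

open Asymptotics Filter MeasureTheory Module Polynomial
open scoped NNReal

section PseudoOrbits

variable {E F : Type*} [NormedAddCommGroup E] [NormedSpace ℝ E] [NormedAddCommGroup F]
  [NormedSpace ℝ F] {B : E →L[ℝ] E} {b : ℝ} {x : ℕ → E}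

/-- A `b`-pseudo-orbit of `B`: a trajectory of `x (t + 1) = B (x t) + v t` for some disturbance `v`
that is bounded by `b`. -/
def IsPseudoOrbit (B : E →L[ℝ] E) (b : ℝ) (x : ℕ → E) : Prop :=
  ∀ t, ‖x (t + 1) - B (x t)‖ ≤ b

namespace IsPseudoOrbit

theorem norm_sub_pow_apply_le (hx : IsPseudoOrbit B b x) (s k : ℕ) :
    ‖x (s + k) - (B ^ k) (x s)‖ ≤ b * ∑ i ∈ Finset.range k, ‖B ^ i‖ := by
  induction k generalizing s with
  | zero => simp
  | succ k ih =>
    calc ‖x (s + (k + 1)) - (B ^ (k + 1)) (x s)‖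
        = ‖(x (s + 1 + k) - (B ^ k) (x (s + 1))) + (B ^ k) (x (s + 1) - B (x s))‖ := by
          rw [pow_succ, mul_apply_eq_comp, map_sub, sub_add_sub_cancel, add_comm k,
            add_assoc]
      _ ≤ b * ∑ i ∈ Finset.range k, ‖B ^ i‖ + ‖B ^ k‖ * b :=
          norm_add_le_of_le (ih (s + 1)) ((B ^ k).le_opNorm_of_le (hx s))
      _ = b * ∑ i ∈ Finset.range (k + 1), ‖B ^ i‖ := by
          rw [Finset.sum_range_succ, mul_add, mul_comm b ‖B ^ k‖]

theorem norm_pow_apply_sub_le (hx : IsPseudoOrbit B b x) (z : E) (s : ℕ) {k N : ℕ} (hk : k ≤ N) :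
    ‖(B ^ k) z - x (s + k)‖ ≤ (‖z - x s‖ + b) * ∑ i ∈ Finset.range (N + 1), ‖B ^ i‖ := by
  have hb : 0 ≤ b := (norm_nonneg _).trans (hx 0)
  have hpow : ‖B ^ k‖ ≤ ∑ i ∈ Finset.range (N + 1), ‖B ^ i‖ :=
    Finset.single_le_sum (f := fun i => ‖B ^ i‖) (fun _ _ => norm_nonneg _)
      (Finset.mem_range.2 (Nat.lt_succ_of_le hk))
  calc ‖(B ^ k) z - x (s + k)‖
      = ‖(B ^ k) (z - x s) - (x (s + k) - (B ^ k) (x s))‖ := by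
        rw [map_sub]; congr 1; abel
    _ ≤ ‖B ^ k‖ * ‖z - x s‖ + b * ∑ i ∈ Finset.range k, ‖B ^ i‖ :=
        norm_sub_le_of_le ((B ^ k).le_opNorm _) (hx.norm_sub_pow_apply_le s k)
    _ ≤ (∑ i ∈ Finset.range (N + 1), ‖B ^ i‖) * ‖z - x s‖
          + b * ∑ i ∈ Finset.range (N + 1), ‖B ^ i‖ := by
        gcongr
        exact hk.trans N.le_succ
    _ = (‖z - x s‖ + b) * ∑ i ∈ Finset.range (N + 1), ‖B ^ i‖ := by ring

theorem norm_le_of_summable (hx : IsPseudoOrbit B b x) (hB : Summable fun i => ‖B ^ i‖) (t : ℕ) :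
    ‖x t‖ ≤ (‖x 0‖ + b) * ∑' i, ‖B ^ i‖ := by
  have hb : 0 ≤ b := (norm_nonneg _).trans (hx 0)
  calc ‖x t‖ = ‖(B ^ t) 0 - x (0 + t)‖ := by rw [map_zero, zero_sub, norm_neg, zero_add]
    _ ≤ (‖0 - x 0‖ + b) * ∑ i ∈ Finset.range (t + 1), ‖B ^ i‖ :=
        hx.norm_pow_apply_sub_le 0 0 le_rfl
    _ ≤ (‖x 0‖ + b) * ∑' i, ‖B ^ i‖ := by
        rw [zero_sub, norm_neg]
        gcongr
        exact hB.sum_le_tsum _ fun _ _ => norm_nonneg _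

theorem sample (hx : IsPseudoOrbit B b x) (n : ℕ) :
    IsPseudoOrbit (B ^ n) (b * ∑ i ∈ Finset.range n, ‖B ^ i‖) fun k => x (k * n) := fun k => by
  simpa only [Nat.succ_mul] using hx.norm_sub_pow_apply_le (k * n) n

theorem map (hx : IsPseudoOrbit B b x) (P : E →L[ℝ] F) {B' : F →L[ℝ] F}
    (h : ∀ z, P (B z) = B' (P z)) : IsPseudoOrbit B' (‖P‖ * b) fun t => P (x t) := fun t => by
  rw [← h, ← map_sub]
  exact P.le_opNorm_of_le (hx t)

theorem of_norm_sub_le (hx : IsPseudoOrbit B b x) {y : ℕ → E} {ε : ℝ}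
    (hy : ∀ t, ‖y t - x t‖ ≤ ε) : IsPseudoOrbit B (ε + b + ‖B‖ * ε) y := fun t =>
  calc ‖y (t + 1) - B (y t)‖
      = ‖(y (t + 1) - x (t + 1)) + (x (t + 1) - B (x t)) - B (y t - x t)‖ := by
        rw [map_sub]; congr 1; abel
    _ ≤ ε + b + ‖B‖ * ε :=
        norm_sub_le_of_le (norm_add_le_of_le (hy _) (hx t)) (B.le_opNorm_of_le (hy t))

end IsPseudoOrbit

end PseudoOrbits

section SpectralGrowth

theorem isBigO_pow_of_spectralRadius_lt {R : Type*} [NormedRing R] [NormedAlgebra ℂ R]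
    [CompleteSpace R] {a : R} {r : ℝ≥0} (h : spectralRadius ℂ a < r) :
    (fun n => a ^ n) =O[atTop] fun n => (r : ℝ) ^ n := by
  have hroot : ∀ᶠ n : ℕ in atTop, ENNReal.ofReal (‖a ^ n‖ ^ (1 / n : ℝ)) < r :=
    (spectrum.pow_norm_pow_one_div_tendsto_nhds_spectralRadius a).eventually (gt_mem_nhds h)
  refine .of_norm_eventuallyLE ?_
  filter_upwards [hroot, eventually_ne_atTop 0] with n hn hn0
  have hlt : ‖a ^ n‖ ^ (1 / n : ℝ) < r := (ENNReal.ofReal_lt_coe_iff (by positivity)).1 hn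
  have hle := pow_le_pow_left₀ (by positivity) hlt.le n
  rwa [one_div, Real.rpow_inv_natCast_pow (norm_nonneg _) hn0] at hle

/-- The matrix `M` as a bounded operator for the supremum norm. -/
noncomputable def mulVecCLM {n : ℕ} :
    Matrix (Fin n) (Fin n) ℝ ≃ₐ[ℝ] ((Fin n → ℝ) →L[ℝ] (Fin n → ℝ)) :=
  Matrix.toLinAlgEquiv'.trans (Module.End.toContinuousLinearMap (Fin n → ℝ))

variable {n : ℕ} {M : Matrix (Fin n) (Fin n) ℝ}

@[simp]
theorem mulVecCLM_apply (M : Matrix (Fin n) (Fin n) ℝ) (x : Fin n → ℝ) :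
    mulVecCLM M x = M.mulVec x :=
  rfl

theorem mulVecCLM_pow_apply (M : Matrix (Fin n) (Fin n) ℝ) (k : ℕ) (x : Fin n → ℝ) :
    (mulVecCLM M ^ k) x = (M ^ k).mulVec x := by
  rw [← map_pow, mulVecCLM_apply]

attribute [local instance] Matrix.linftyOpNormedRing Matrix.linftyOpNormedAlgebra

theorem norm_mulVecCLM (M : Matrix (Fin n) (Fin n) ℝ) :
    ‖mulVecCLM M‖ = ‖M.map (algebraMap ℝ ℂ)‖ := by
  have hM : ‖M.map (algebraMap ℝ ℂ)‖ = ‖M‖ := by simp [Matrix.linfty_opNorm_def]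
  rw [hM, Matrix.linfty_opNorm_eq_opNorm]
  rfl

theorem mem_eigenvalues_iff {z : ℂ} :
    z ∈ eigenvalues M ↔ z ∈ spectrum ℂ (M.map (algebraMap ℝ ℂ)) := by
  rw [Matrix.mem_spectrum_iff_isRoot_charpoly, eigenvalues, mem_roots]
  exact (Matrix.charpoly_monic _).ne_zero

theorem aeval_eq_zero_of_mem_eigenvalues {p : ℝ[X]} (hp : aeval M p = 0) {z : ℂ}
    (hz : z ∈ eigenvalues M) : aeval z p = 0 := by
  have hp' : aeval (M.map (algebraMap ℝ ℂ)) (p.map (algebraMap ℝ ℂ)) = 0 := by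
    rw [aeval_map_algebraMap]
    exact (aeval_algHom_apply (Algebra.ofId ℝ ℂ).mapMatrix M p).trans (by rw [hp, map_zero])
  have hmem := spectrum.subset_polynomial_aeval (M.map (algebraMap ℝ ℂ)) (p.map (algebraMap ℝ ℂ))
    ⟨z, mem_eigenvalues_iff.1 hz, rfl⟩
  rw [hp'] at hmem
  cases subsingleton_or_nontrivial (Matrix (Fin n) (Fin n) ℂ)
  · simp [spectrum.of_subsingleton] at hmem
  · simpa [eval_map_algebraMap] using hmem

theorem spectralRadius_lt_of_forall_mem_eigenvalues [NeZero n] {r : ℝ≥0}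
    (h : ∀ z ∈ eigenvalues M, ‖z‖ < r) : spectralRadius ℂ (M.map (algebraMap ℝ ℂ)) < r :=
  have := FiniteDimensional.complete ℂ (Matrix (Fin n) (Fin n) ℂ)
  spectrum.spectralRadius_lt_of_forall_lt _ fun z hz => h z (mem_eigenvalues_iff.2 hz)

theorem exists_isBigO_mulVecCLM_pow {r : ℝ} (hr : 0 < r) (h : ∀ z ∈ eigenvalues M, ‖z‖ < r) :
    ∃ ρ, 0 ≤ ρ ∧ ρ < r ∧ (fun k => mulVecCLM M ^ k) =O[atTop] fun k => ρ ^ k := by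
  rcases eq_zero_or_neZero n with rfl | _
  · exact ⟨0, le_rfl, hr, .congr_left (isBigO_zero _ _) fun k => Subsingleton.elim _ _⟩
  lift r to ℝ≥0 using hr.le
  have := FiniteDimensional.complete ℂ (Matrix (Fin n) (Fin n) ℂ)
  obtain ⟨ρ, hMρ, hρr⟩ :=
    ENNReal.lt_iff_exists_nnreal_btwn.1 (spectralRadius_lt_of_forall_mem_eigenvalues h)
  refine ⟨ρ, ρ.coe_nonneg, by exact_mod_cast hρr, ?_⟩
  have hnorm (k : ℕ) : ‖M.map (algebraMap ℝ ℂ) ^ k‖ = ‖mulVecCLM M ^ k‖ := by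
    rw [← map_pow, norm_mulVecCLM]
    exact congrArg _ (map_pow (algebraMap ℝ ℂ).mapMatrix M k).symm
  exact ((isBigO_pow_of_spectralRadius_lt hMρ).norm_left.congr_left hnorm).of_norm_left

theorem exists_norm_mulVecCLM_pow_le {r : ℝ} (hr : 0 < r) (h : ∀ z ∈ eigenvalues M, ‖z‖ < r) :
    ∃ c, 0 < c ∧ ∀ k, ‖mulVecCLM M ^ k‖ ≤ c * r ^ k := by
  obtain ⟨ρ, hρ0, hρr, hO⟩ := exists_isBigO_mulVecCLM_pow hr h
  have hρ : (fun k => ρ ^ k) =O[atTop] fun k : ℕ => r ^ k := .of_norm_le fun k => by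
    rw [Real.norm_of_nonneg (pow_nonneg hρ0 k)]
    gcongr
  obtain ⟨c, hc, hle⟩ := bound_of_isBigO_nat_atTop (hO.trans hρ)
  refine ⟨c, hc, fun k => (hle (pow_pos hr k).ne').trans_eq ?_⟩
  rw [Real.norm_of_nonneg (pow_pos hr k).le]

theorem summable_norm_mulVecCLM_pow (h : ∀ z ∈ eigenvalues M, ‖z‖ < 1) :
    Summable fun k => ‖mulVecCLM M ^ k‖ := by
  obtain ⟨ρ, hρ0, hρ1, hO⟩ := exists_isBigO_mulVecCLM_pow one_pos h
  exact summable_of_isBigO_nat (summable_geometric_of_lt_one hρ0 hρ1) hO.norm_left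

end SpectralGrowth

section Splitting

section Annihilation

variable {R V W : Type*} [CommSemiring R] [AddCommMonoid V] [Module R V] [AddCommMonoid W]
  [Module R W]

theorem map_aeval_apply {f : Module.End R V} {g : Module.End R W} {L : V →ₗ[R] W}
    (h : ∀ x, L (f x) = g (L x)) (p : R[X]) (x : V) : L (aeval f p x) = aeval g p (L x) := by
  induction p using Polynomial.induction_on' with
  | add p q hp hq => simp only [map_add, LinearMap.add_apply, hp, hq]
  | monomial k c =>
    have hpow : L ((f ^ k) x) = (g ^ k) (L x) := by
      induction k with
      | zero => rfl
      | succ k ih => simp only [pow_succ', Module.End.mul_apply, h, ih]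
    simp only [aeval_monomial, Module.End.mul_apply, Module.algebraMap_end_apply, map_smul, hpow]

theorem apply_mem_ker_aeval (f : Module.End R V) (p : R[X]) :
    ∀ x ∈ LinearMap.ker (aeval f p), f x ∈ LinearMap.ker (aeval f p) := fun x hx => by
  rw [LinearMap.mem_ker] at hx ⊢
  rw [← map_aeval_apply (L := f) (fun _ => rfl) p x, hx, map_zero]

theorem aeval_restrict_ker_aeval (f : Module.End R V) (p : R[X]) :
    aeval (f.restrict (apply_mem_ker_aeval f p)) p = 0 :=
  LinearMap.ext fun x => Subtype.ext <|
    (map_aeval_apply (L := (LinearMap.ker (aeval f p)).subtype) (fun _ => rfl) p x).trans x.2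

end Annihilation

section Blocks

variable {K V : Type*} [Field K] [AddCommGroup V] [Module K V] [FiniteDimensional K V]

theorem exists_matrix_of_aeval_eq_zero {g : Module.End K V} {p : K[X]} (hg : aeval g p = 0) :
    ∃ (a : ℕ) (M : Matrix (Fin a) (Fin a) K) (e : V ≃ₗ[K] (Fin a → K)),
      (∀ x, e (g x) = M.mulVec (e x)) ∧ aeval M p = 0 := by
  let b := Module.finBasis K V
  refine ⟨_, LinearMap.toMatrixAlgEquiv b g, b.equivFun,
    fun x => (LinearMap.toMatrix_mulVec_repr b b g x).symm, ?_⟩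
  exact (aeval_algHom_apply (LinearMap.toMatrixAlgEquiv b).toAlgHom g p).trans
    (by rw [hg, map_zero])

theorem exists_blockDiagonal_of_isCoprime {f : Module.End K V} {p q : K[X]} (hpq : IsCoprime p q)
    (hf : aeval f (p * q) = 0) :
    ∃ (a b : ℕ) (M : Matrix (Fin a) (Fin a) K) (N : Matrix (Fin b) (Fin b) K)
      (e : V ≃ₗ[K] (Fin a → K) × (Fin b → K)),
      (∀ x, e (f x) = (M.mulVec (e x).1, N.mulVec (e x).2)) ∧
        aeval M p = 0 ∧ aeval N q = 0 := by
  have hcompl : IsCompl (LinearMap.ker (aeval f p)) (LinearMap.ker (aeval f q)) := by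
    refine ⟨disjoint_ker_aeval_of_isCoprime f hpq, codisjoint_iff.2 ?_⟩
    rw [sup_ker_aeval_eq_ker_aeval_mul_of_coprime f hpq, hf, LinearMap.ker_zero]
  obtain ⟨a, M, eM, heM, hM⟩ := exists_matrix_of_aeval_eq_zero (aeval_restrict_ker_aeval f p)
  obtain ⟨b, N, eN, heN, hN⟩ := exists_matrix_of_aeval_eq_zero (aeval_restrict_ker_aeval f q)
  let e := Submodule.prodEquivOfIsCompl _ _ hcompl
  refine ⟨a, b, M, N, e.symm.trans (eM.prodCongr eN), fun x => ?_, hM, hN⟩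
  obtain ⟨y, rfl⟩ := e.surjective x
  have hfe : f (e y) = e (f.restrict (apply_mem_ker_aeval f p) y.1,
      f.restrict (apply_mem_ker_aeval f q) y.2) := map_add f _ _
  simp [hfe, heM, heN]

end Blocks

theorem norm_eq_of_irreducible {f : ℝ[X]} (hf : Irreducible f) {z w : ℂ} (hz : aeval z f = 0)
    (hw : aeval w f = 0) : ‖z‖ = ‖w‖ := by
  have hconj : IsConjRoot ℝ w z := by
    rw [IsConjRoot, ← minpoly.eq_of_irreducible hf hz, ← minpoly.eq_of_irreducible hf hw]
  have : Normal ℝ ℂ := normal_iff.2 fun x =>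
    ⟨Algebra.IsIntegral.isIntegral x, IsAlgClosed.splits _⟩
  obtain ⟨σ, rfl⟩ := isConjRoot_iff_exists_algEquiv.1 hconj
  rcases Complex.real_algHom_eq_id_or_conj σ.toAlgHom with hσ | hσ
  · exact congrArg norm (DFunLike.congr_fun hσ z).symm
  · exact ((congrArg norm (DFunLike.congr_fun hσ z)).trans (Complex.norm_conj z)).symm

theorem exists_eq_mul_unit_disc {p : ℝ[X]} (hp : p ≠ 0) :
    ∃ pu ps : ℝ[X], p = pu * ps ∧ (∀ z : ℂ, aeval z pu = 0 → 1 ≤ ‖z‖) ∧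
      ∀ z : ℂ, aeval z ps = 0 → ‖z‖ < 1 := by
  induction p using UniqueFactorizationMonoid.induction_on_prime with
  | h₁ => exact absurd rfl hp
  | h₂ u hu =>
    exact ⟨u, 1, (mul_one u).symm, fun z hz => absurd hz (hu.map (aeval z)).ne_zero, by simp⟩
  | h₃ a f ha hf ih =>
    obtain ⟨pu, ps, rfl, hu, hs⟩ := ih ha
    by_cases hroots : ∀ z : ℂ, aeval z f = 0 → 1 ≤ ‖z‖
    · refine ⟨f * pu, ps, (mul_assoc f pu ps).symm, fun z hz => ?_, hs⟩
      rw [map_mul, mul_eq_zero] at hz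
      exact hz.elim (hroots z) (hu z)
    · push Not at hroots
      obtain ⟨w, hw, hw1⟩ := hroots
      refine ⟨pu, f * ps, mul_left_comm f pu ps, hu, fun z hz => ?_⟩
      rw [map_mul, mul_eq_zero] at hz
      exact hz.elim (fun hz => norm_eq_of_irreducible hf.irreducible hz hw ▸ hw1) (hs z)

/-- A splitting of `x ↦ A x` into an unstable part, with eigenvalues outside the open unit disc,
and a stable part, with eigenvalues inside. -/
structure UnitCircleSplitting {n : ℕ} (A : Matrix (Fin n) (Fin n) ℝ) where
  {unstableDim stableDim : ℕ}
  unstable : Matrix (Fin unstableDim) (Fin unstableDim) ℝ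
  stable : Matrix (Fin stableDim) (Fin stableDim) ℝ
  coords : (Fin n → ℝ) ≃ₗ[ℝ] (Fin unstableDim → ℝ) × (Fin stableDim → ℝ)
  coords_mulVec : ∀ x,
    coords (A.mulVec x) = (unstable.mulVec (coords x).1, stable.mulVec (coords x).2)
  one_le_norm : ∀ z ∈ eigenvalues unstable, 1 ≤ ‖z‖
  norm_lt_one : ∀ z ∈ eigenvalues stable, ‖z‖ < 1

theorem norm_det_eq_prod_eigenvalues {n : ℕ} (M : Matrix (Fin n) (Fin n) ℝ) :
    ‖M.det‖ = ((eigenvalues M).map (‖·‖)).prod := by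
  have hdet : (M.det : ℂ) = (eigenvalues M).prod :=
    ((algebraMap ℝ ℂ).map_det M).trans (Matrix.det_eq_prod_roots_charpoly _)
  rw [← Complex.norm_real, hdet]
  exact map_multiset_prod (normHom : ℂ →*₀ ℝ) _

theorem one_le_norm_det {n : ℕ} {M : Matrix (Fin n) (Fin n) ℝ}
    (h : ∀ z ∈ eigenvalues M, 1 ≤ ‖z‖) : 1 ≤ ‖M.det‖ := by
  rw [norm_det_eq_prod_eigenvalues]
  exact Multiset.prod_induction (1 ≤ ·) _ (fun _ _ => one_le_mul_of_one_le_of_one_le) le_rfl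
    (Multiset.forall_mem_map_iff.2 h)

namespace UnitCircleSplitting

variable {n : ℕ} {A : Matrix (Fin n) (Fin n) ℝ}

theorem nonempty (A : Matrix (Fin n) (Fin n) ℝ) : Nonempty (UnitCircleSplitting A) := by
  obtain ⟨pu, ps, hp, hu, hs⟩ := exists_eq_mul_unit_disc (Matrix.charpoly_monic A).ne_zero
  have hcop : IsCoprime pu ps := by
    rw [isCoprime_iff_aeval_ne_zero_of_isAlgClosed ℝ ℂ]
    intro z
    by_contra! hz
    exact (hs z hz.2).not_ge (hu z hz.1)
  have hA : aeval (Matrix.toLin' A) (pu * ps) = 0 := by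
    rw [← hp, ← Matrix.charpoly_toLin', LinearMap.aeval_self_charpoly]
  obtain ⟨_, _, M, N, e, he, hM, hN⟩ := exists_blockDiagonal_of_isCoprime hcop hA
  exact ⟨M, N, e, he, fun z hz => hu z (aeval_eq_zero_of_mem_eigenvalues hM hz),
    fun z hz => hs z (aeval_eq_zero_of_mem_eigenvalues hN hz)⟩

variable (σ : UnitCircleSplitting A)

theorem charpoly_eq : A.charpoly = σ.unstable.charpoly * σ.stable.charpoly := by
  have hconj : σ.coords.conj (Matrix.toLin' A) =
      (Matrix.toLin' σ.unstable).prodMap (Matrix.toLin' σ.stable) :=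
    LinearMap.ext fun x => by simp [LinearEquiv.conj_apply_apply, σ.coords_mulVec]
  rw [← Matrix.charpoly_toLin', ← σ.coords.charpoly_conj, hconj, LinearMap.charpoly_prodMap,
    Matrix.charpoly_toLin', Matrix.charpoly_toLin']

theorem eigenvalues_eq : eigenvalues A = eigenvalues σ.unstable + eigenvalues σ.stable := by
  simp only [eigenvalues, Matrix.charpoly_map, σ.charpoly_eq, Polynomial.map_mul]
  exact roots_mul (mul_ne_zero ((Matrix.charpoly_monic _).map _).ne_zero
    ((Matrix.charpoly_monic _).map _).ne_zero)

theorem linEntropy_eq (q : ℕ) : linEntropy q A = Real.logb q ‖σ.unstable.det‖ := by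
  rw [linEntropy, σ.eigenvalues_eq, Multiset.filter_add, Multiset.filter_eq_self.2 σ.one_le_norm,
    Multiset.filter_eq_nil.2 fun z hz => (σ.norm_lt_one z hz).not_ge, add_zero,
    norm_det_eq_prod_eigenvalues, Real.logb, Real.log_multiset_prod, Multiset.map_map,
    ← Multiset.sum_map_div]
  · rfl
  · exact Multiset.forall_mem_map_iff.2 fun z hz =>
      (zero_lt_one.trans_le (σ.one_le_norm z hz)).ne'

theorem one_le_norm_det_unstable : 1 ≤ ‖σ.unstable.det‖ :=
  one_le_norm_det σ.one_le_norm

end UnitCircleSplitting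

end Splitting

section Packing

theorem exists_finset_isSeparated_net {E : Type*} [MetricSpace E] {K : Set E} (hK : IsCompact K)
    {δ : ℝ} (hδ : 0 < δ) :
    ∃ T : Finset E, ↑T ⊆ K ∧ (T : Set E).Pairwise (fun x y => δ < dist x y) ∧
      K ⊆ ⋃ t ∈ T, Metric.closedBall t δ := by
  lift δ to NNReal using hδ.le
  have hpack : Metric.packingNumber δ K ≠ ⊤ := by
    obtain ⟨N, -, hfin, hN⟩ := Metric.exists_finite_isCover_of_isCompact (ε := δ / 2)
      (by simpa using hδ.ne') hK
    rw [show δ = 2 * (δ / 2) from (mul_div_cancel₀ δ two_ne_zero).symm]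
    exact ne_top_of_le_ne_top (Set.encard_ne_top_iff.2 hfin)
      ((Metric.packingNumber_two_mul_le_externalCoveringNumber (δ / 2) K).trans
        hN.externalCoveringNumber_le_encard)
  have hfin : (Metric.maximalSeparatedSet δ K).Finite := by
    rw [← Set.encard_ne_top_iff, Metric.encard_maximalSeparatedSet hpack]
    exact hpack
  refine ⟨hfin.toFinset, ?_, ?_, ?_⟩
  · simpa using Metric.maximalSeparatedSet_subset
  · intro x hx y hy hxy
    have hsep : (δ : ENNReal) < edist x y := Metric.isSeparated_maximalSeparatedSet
      (hfin.mem_toFinset.1 hx) (hfin.mem_toFinset.1 hy) hxy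
    rw [edist_nndist, ENNReal.coe_lt_coe] at hsep
    exact_mod_cast hsep
  · simpa using Metric.isCover_iff_subset_iUnion_closedBall.1
      (Metric.isCover_maximalSeparatedSet hpack)

variable {E : Type*} [NormedAddCommGroup E] [NormedSpace ℝ E] [FiniteDimensional ℝ E]

theorem measureReal_image_closedBall [MeasurableSpace E] [BorelSpace E] (μ : Measure E)
    [μ.IsAddHaarMeasure] (B : E →L[ℝ] E) {r : ℝ} (hr : 0 ≤ r) :
    μ.real (B '' Metric.closedBall 0 r) =
      |B.det| * r ^ finrank ℝ E * μ.real (Metric.ball 0 1) := by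
  rw [measureReal_def, Measure.addHaar_image_continuousLinearMap, ENNReal.toReal_mul,
    ENNReal.toReal_ofReal (abs_nonneg _), ← measureReal_def, Measure.addHaar_real_closedBall _ _ hr,
    mul_assoc]

theorem measureReal_ball_zero_one_pos [MeasurableSpace E] (μ : Measure E) [μ.IsAddHaarMeasure] :
    0 < μ.real (Metric.ball (0 : E) 1) :=
  ENNReal.toReal_pos (Metric.measure_ball_pos μ 0 one_pos).ne' measure_ball_lt_top.ne

theorem abs_det_mul_pow_le_card {B : E →L[ℝ] E} {l δ : ℝ} (hl : 0 ≤ l) (hδ : 0 < δ) {T : Finset E}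
    (hT : B '' Metric.closedBall 0 l ⊆ ⋃ t ∈ T, Metric.closedBall t δ) :
    |B.det| * (l / δ) ^ finrank ℝ E ≤ T.card := by
  borelize E
  let μ : Measure E := Measure.addHaar
  have hvol : |B.det| * l ^ finrank ℝ E * μ.real (Metric.ball 0 1) ≤
      T.card * δ ^ finrank ℝ E * μ.real (Metric.ball 0 1) :=
    calc |B.det| * l ^ finrank ℝ E * μ.real (Metric.ball 0 1)
        = μ.real (B '' Metric.closedBall 0 l) := (measureReal_image_closedBall μ B hl).symm
      _ ≤ μ.real (⋃ t ∈ T, Metric.closedBall t δ) :=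
          measureReal_mono hT
            ((measure_biUnion_lt_top T.finite_toSet fun _ _ => measure_closedBall_lt_top).ne)
      _ ≤ ∑ t ∈ T, μ.real (Metric.closedBall t δ) := measureReal_biUnion_finset_le T _
      _ = T.card * δ ^ finrank ℝ E * μ.real (Metric.ball 0 1) := by
          simp only [Measure.addHaar_real_closedBall μ _ hδ.le, Finset.sum_const, nsmul_eq_mul,
            mul_assoc]
  rw [div_pow, mul_div_assoc', div_le_iff₀ (by positivity)]
  exact le_of_mul_le_mul_right hvol (measureReal_ball_zero_one_pos μ)

theorem card_mul_pow_le_abs_det {B : E →L[ℝ] E} {l δ : ℝ} (hl : 0 ≤ l) (hδ : 0 < δ) {T : Finset E}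
    (hT : (T : Set E).Pairwise fun x y => δ < dist x y)
    (hsub : ∀ t ∈ T, Metric.closedBall t (δ / 2) ⊆ B '' Metric.closedBall 0 l) :
    T.card * (δ / 2) ^ finrank ℝ E ≤ |B.det| * l ^ finrank ℝ E := by
  borelize E
  let μ : Measure E := Measure.addHaar
  have hdisj : (T : Set E).PairwiseDisjoint fun t => Metric.closedBall t (δ / 2) :=
    fun x hx y hy hxy => Metric.closedBall_disjoint_closedBall (by linarith [hT hx hy hxy])
  have hfin : μ (B '' Metric.closedBall 0 l) ≠ ⊤ :=
    ((isCompact_closedBall (0 : E) l).image B.continuous).measure_ne_top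
  have hvol : T.card * (δ / 2) ^ finrank ℝ E * μ.real (Metric.ball 0 1) ≤
      |B.det| * l ^ finrank ℝ E * μ.real (Metric.ball 0 1) :=
    calc T.card * (δ / 2) ^ finrank ℝ E * μ.real (Metric.ball 0 1)
        = ∑ t ∈ T, μ.real (Metric.closedBall t (δ / 2)) := by
          simp only [Measure.addHaar_real_closedBall μ _ (half_pos hδ).le, Finset.sum_const,
            nsmul_eq_mul, mul_assoc]
      _ = μ.real (⋃ t ∈ T, Metric.closedBall t (δ / 2)) :=
          (measureReal_biUnion_finset hdisj (fun _ _ => measurableSet_closedBall)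
            fun _ _ => measure_closedBall_lt_top.ne).symm
      _ ≤ μ.real (B '' Metric.closedBall 0 l) := measureReal_mono (Set.iUnion₂_subset hsub) hfin
      _ = |B.det| * l ^ finrank ℝ E * μ.real (Metric.ball 0 1) :=
          measureReal_image_closedBall μ B hl
  exact le_of_mul_le_mul_right hvol (measureReal_ball_zero_one_pos μ)

theorem exists_isSeparated_image (B : E →L[ℝ] E) {l δ : ℝ} (hl : 0 ≤ l) (hδ : 0 < δ) :
    ∃ T : Finset E, (∀ x ∈ T, ‖x‖ ≤ l) ∧
      (T : Set E).Pairwise (fun x y => δ < ‖B (x - y)‖) ∧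
        |B.det| * (l / δ) ^ finrank ℝ E ≤ T.card := by
  classical
  obtain ⟨T, hTB, hsep, hnet⟩ :=
    exists_finset_isSeparated_net ((isCompact_closedBall (0 : E) l).image B.continuous) hδ
  have hpre : ∀ t ∈ T, ∃ x, x ∈ Metric.closedBall 0 l ∧ B x = t :=
    fun t ht => hTB (Finset.mem_coe.2 ht)
  choose! g hg hgB using hpre
  have hinj : Set.InjOn g T := fun s hs t ht hst => by rw [← hgB s hs, hst, hgB t ht]
  refine ⟨T.image g, ?_, ?_, ?_⟩
  · simpa using hg
  · rw [Finset.coe_image, Set.InjOn.pairwise_image hinj]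
    intro s hs t ht hst
    simpa [Function.onFun, hgB s hs, hgB t ht, dist_eq_norm] using hsep hs ht hst
  · rw [Finset.card_image_of_injOn hinj]
    exact abs_det_mul_pow_le_card hl hδ hnet

/-- A half-net of an operator covers the image of the closed unit ball up to distance `1 / 2`:
naming one of its points halves the uncertainty about `B x` relative to the uncertainty about `x`.
The ratio `1 / 2` leaves the other half for the disturbances. -/
def IsHalfNet (B : E →L[ℝ] E) (T : Finset E) : Prop :=
  ∀ x, ‖x‖ ≤ 1 → ∃ y ∈ T, ‖B x - y‖ ≤ 1 / 2

theorem exists_isHalfNet (B : (E →L[ℝ] E)ˣ) :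
    ∃ T : Finset E, IsHalfNet (B : E →L[ℝ] E) T ∧
      T.card ≤ |(B : E →L[ℝ] E).det| * (4 + ‖(↑B⁻¹ : E →L[ℝ] E)‖) ^ finrank ℝ E := by
  have hBinv (x : E) : (↑B⁻¹ : E →L[ℝ] E) ((B : E →L[ℝ] E) x) = x :=
    DFunLike.congr_fun B.inv_mul x
  have hinvB (x : E) : (B : E →L[ℝ] E) ((↑B⁻¹ : E →L[ℝ] E) x) = x :=
    DFunLike.congr_fun B.mul_inv x
  set c := ‖(↑B⁻¹ : E →L[ℝ] E)‖
  obtain ⟨T, hTB, hsep, hnet⟩ := exists_finset_isSeparated_net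
    ((isCompact_closedBall (0 : E) 1).image (B : E →L[ℝ] E).continuous) (one_half_pos (α := ℝ))
  refine ⟨T, fun x hx => ?_, ?_⟩
  · have hmem := hnet ⟨x, mem_closedBall_zero_iff.2 hx, rfl⟩
    simpa [dist_eq_norm] using hmem
  · have hsub : ∀ t ∈ T, Metric.closedBall t (1 / 2 / 2) ⊆
        (B : E →L[ℝ] E) '' Metric.closedBall 0 (1 + c * (1 / 2 / 2)) := by
      intro t ht y hy
      obtain ⟨u, hu, rfl⟩ := hTB ht
      refine ⟨(↑B⁻¹ : E →L[ℝ] E) y, ?_, hinvB y⟩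
      rw [mem_closedBall_zero_iff] at hu ⊢
      rw [mem_closedBall_iff_norm] at hy
      calc ‖(↑B⁻¹ : E →L[ℝ] E) y‖
          = ‖u + (↑B⁻¹ : E →L[ℝ] E) (y - (B : E →L[ℝ] E) u)‖ := by
            rw [map_sub, hBinv, add_sub_cancel]
        _ ≤ 1 + c * (1 / 2 / 2) :=
            norm_add_le_of_le hu (ContinuousLinearMap.le_opNorm_of_le _ hy)
    have hcard := card_mul_pow_le_abs_det (by positivity) one_half_pos hsep hsub
    rw [show 1 + c * (1 / 2 / 2) = (4 + c) * (1 / 2 / 2) by ring, mul_pow, ← mul_assoc] at hcard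
    exact le_of_mul_le_mul_right hcard (by positivity)

/-- The volume bound leaves room for the subexponential growth of the inverses. -/
theorem eventually_exists_isHalfNet_pow (B : (E →L[ℝ] E)ˣ)
    (hB : ∀ θ > 1, ∃ c, ∀ k, ‖(↑B⁻¹ : E →L[ℝ] E) ^ k‖ ≤ c * θ ^ k)
    (hdet : 1 ≤ |(B : E →L[ℝ] E).det|) {g : ℝ} (hg : |(B : E →L[ℝ] E).det| < g) :
    ∀ᶠ k in atTop, ∃ T : Finset E,
      IsHalfNet ((B : E →L[ℝ] E) ^ k) T ∧ (T.card : ℝ) + 1 ≤ g ^ k := by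
  set Δ := |(B : E →L[ℝ] E).det|
  set d := finrank ℝ E
  obtain ⟨θ, hθ1, hθ⟩ : ∃ θ > 1, Δ * θ ^ d < g :=
    (((continuous_const.mul (continuous_pow d)).tendsto' (1 : ℝ) Δ
      (by simp [Δ])).eventually (gt_mem_nhds hg)).exists_gt
  obtain ⟨c, hc⟩ := hB θ hθ1
  have hc0 : 0 ≤ c := by simpa using (norm_nonneg _).trans (hc 0)
  have hg0 : 0 < g := zero_lt_one.trans (hdet.trans_lt hg)
  have hlittle : ∀ᶠ k in atTop,
      ‖((4 + c) ^ d + 1) * (Δ * θ ^ d) ^ k‖ ≤ 1 * ‖g ^ k‖ :=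
    ((isLittleO_pow_pow_of_lt_left (by positivity) hθ).const_mul_left _).bound one_pos
  filter_upwards [hlittle] with k hk
  rw [one_mul, Real.norm_of_nonneg (by positivity), Real.norm_of_nonneg (by positivity)] at hk
  obtain ⟨T, hnet, hT⟩ := exists_isHalfNet (B ^ k)
  rw [← inv_pow, Units.val_pow_eq_pow_val, Units.val_pow_eq_pow_val] at hT
  refine ⟨T, by rwa [Units.val_pow_eq_pow_val] at hnet, ?_⟩
  have hθk : 1 ≤ θ ^ k := one_le_pow₀ hθ1.le
  have hdetk : |((B : E →L[ℝ] E) ^ k).det| = Δ ^ k := by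
    rw [← abs_pow]
    exact congrArg abs ((congrArg LinearMap.det (ContinuousLinearMap.toLinearMap_pow _ k)).trans
      (map_pow LinearMap.det _ k))
  calc (T.card : ℝ) + 1
      ≤ Δ ^ k * (4 + c * θ ^ k) ^ d + 1 := by
        rw [hdetk] at hT
        refine add_le_add_left (hT.trans ?_) 1
        gcongr
        exact hc k
    _ ≤ Δ ^ k * ((4 + c) * θ ^ k) ^ d + Δ ^ k * (θ ^ k) ^ d := by
        gcongr
        · nlinarith
        · exact one_le_mul_of_one_le_of_one_le (one_le_pow₀ hdet) (one_le_pow₀ hθk)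
    _ = ((4 + c) ^ d + 1) * (Δ * θ ^ d) ^ k := by
        rw [mul_pow, mul_pow, ← pow_mul, ← pow_mul, mul_comm k d]
        ring
    _ ≤ g ^ k := hk

end Packing

section UnstableNets

variable {n : ℕ} {M : Matrix (Fin n) (Fin n) ℝ}

theorem det_mulVecCLM (M : Matrix (Fin n) (Fin n) ℝ) : (mulVecCLM M).det = M.det :=
  LinearMap.det_toLin' M

theorem norm_le_one_of_mem_eigenvalues_inv (U : (Matrix (Fin n) (Fin n) ℝ)ˣ)
    (h : ∀ z ∈ eigenvalues (U : Matrix (Fin n) (Fin n) ℝ), 1 ≤ ‖z‖) {z : ℂ}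
    (hz : z ∈ eigenvalues (↑U⁻¹ : Matrix (Fin n) (Fin n) ℝ)) : ‖z‖ ≤ 1 := by
  rcases eq_or_ne z 0 with rfl | hz0
  · simp
  let V := Units.map ((algebraMap ℝ ℂ).mapMatrix : Matrix (Fin n) (Fin n) ℝ →+* _).toMonoidHom U
  have hz' : ((Units.mk0 z hz0 : ℂˣ) : ℂ) ∈ spectrum ℂ (↑V⁻¹ : Matrix (Fin n) (Fin n) ℂ) :=
    mem_eigenvalues_iff.1 hz
  have hinv := h _ (mem_eigenvalues_iff.2 (spectrum.inv_mem_iff.1 hz'))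
  rw [Units.val_inv_eq_inv_val, Units.val_mk0, norm_inv] at hinv
  exact (one_le_inv₀ (norm_pos_iff.2 hz0)).1 hinv

theorem eventually_exists_isHalfNet_mulVecCLM_pow (hM : ∀ z ∈ eigenvalues M, 1 ≤ ‖z‖) {g : ℝ}
    (hg : ‖M.det‖ < g) :
    ∀ᶠ k in atTop, ∃ T : Finset (Fin n → ℝ),
      IsHalfNet (mulVecCLM M ^ k) T ∧ (T.card : ℝ) + 1 ≤ g ^ k := by
  have hdet := one_le_norm_det hM
  obtain ⟨U, rfl⟩ : IsUnit M := by
    rw [Matrix.isUnit_iff_isUnit_det, isUnit_iff_ne_zero, ← norm_pos_iff]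
    exact zero_lt_one.trans_le hdet
  rw [Real.norm_eq_abs, ← det_mulVecCLM] at hdet hg
  obtain ⟨B, hB, hBinv⟩ : ∃ B : ((Fin n → ℝ) →L[ℝ] (Fin n → ℝ))ˣ,
      (B : (Fin n → ℝ) →L[ℝ] (Fin n → ℝ)) = mulVecCLM (U : Matrix (Fin n) (Fin n) ℝ) ∧
        (↑B⁻¹ : (Fin n → ℝ) →L[ℝ] (Fin n → ℝ)) =
          mulVecCLM (↑U⁻¹ : Matrix (Fin n) (Fin n) ℝ) :=
    ⟨Units.mapEquiv mulVecCLM.toMulEquiv U, rfl, rfl⟩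
  rw [← hB] at hdet hg ⊢
  refine eventually_exists_isHalfNet_pow B (fun θ hθ => ?_) hdet hg
  obtain ⟨c, -, hc⟩ := exists_norm_mulVecCLM_pow_le (zero_lt_one.trans hθ) fun z hz =>
    (norm_le_one_of_mem_eigenvalues_inv U hM hz).trans_lt hθ
  exact ⟨c, by rwa [hBinv]⟩

end UnstableNets

namespace FiniteStateChannel

variable {X Y S M : Type*} {ch : FiniteStateChannel X Y S}

theorem CanOutput.block {n : ℕ} {x : Fin n → X} {y : Fin n → Y} (h : ch.CanOutput x y) (a m : ℕ)
    (ham : a + m ≤ n) :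
    ch.CanOutput (fun i : Fin m => x ⟨a + i, by lia⟩) fun i : Fin m => y ⟨a + i, by lia⟩ := by
  obtain ⟨s, hs⟩ := h
  exact ⟨fun i => s ⟨a + i, by lia⟩, fun i => hs ⟨a + i, by lia⟩⟩

theorem CanOutputSeq.block {x : ℕ → X} {y : ℕ → Y} (h : ch.CanOutputSeq x y) (a m : ℕ) :
    ch.CanOutput (fun i : Fin m => x (a + i)) fun i : Fin m => y (a + i) := by
  obtain ⟨s, hs⟩ := h
  exact ⟨fun i => s (a + i), fun i => hs (a + i)⟩

theorem exists_response_from (ch : FiniteStateChannel X Y S) (s₀ : S) (x : ℕ → X) :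
    ∃ (s : ℕ → S) (y : ℕ → Y), s 0 = s₀ ∧ ∀ t, ch.trans (s t) (x t) (y t) (s (t + 1)) := by
  choose out next hnext using ch.range_nonempty
  let s : ℕ → S := fun t => Nat.rec s₀ (fun k sk => next sk (x k)) t
  exact ⟨s, fun t => out (s t) (x t), rfl, fun t => hnext (s t) (x t)⟩

theorem CanOutput.exists_extension {m : ℕ} {x : ℕ → X} {y : Fin m → Y}
    (h : ch.CanOutput (fun i : Fin m => x i) y) :
    ∃ r : ℕ → Y, ch.CanOutputSeq x r ∧ ∀ i : Fin m, r i = y i := by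
  obtain ⟨s, hs⟩ := h
  obtain ⟨s', y', hs'0, hs'⟩ := ch.exists_response_from (s (Fin.last m)) fun k => x (m + k)
  let state : ℕ → S := fun t => if ht : t ≤ m then s ⟨t, by lia⟩ else s' (t - m)
  have hstate (k : ℕ) : state (m + k) = s' k := by
    rcases k.eq_zero_or_pos with rfl | hk
    · rw [hs'0]
      exact dif_pos le_rfl
    · simp [state, hk.ne']
  refine ⟨fun t => if ht : t < m then y ⟨t, ht⟩ else y' (t - m), ⟨state, fun t => ?_⟩,
    fun i => dif_pos i.2⟩
  rcases lt_or_ge t m with ht | ht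
  · simp only [state, ht, ht.le, Nat.succ_le_of_lt ht, dif_pos]
    exact hs ⟨t, ht⟩
  · obtain ⟨k, rfl⟩ := Nat.exists_eq_add_of_le ht
    simpa only [add_assoc, hstate, dif_neg ht.not_gt, Nat.add_sub_cancel_left] using hs' k

theorem exists_canOutput [Nonempty S] (ch : FiniteStateChannel X Y S) {m : ℕ} (x : Fin m → X) :
    ∃ y, ch.CanOutput x y := by
  obtain ⟨s₀⟩ := ‹Nonempty S›
  cases m with
  | zero => exact ⟨Fin.elim0, fun _ => s₀, fun i => i.elim0⟩
  | succ m =>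
    obtain ⟨s, y, -, hs⟩ := ch.exists_response_from s₀ fun t => x (Fin.ofNat (m + 1) t)
    refine ⟨fun i => y i, fun i => s i, fun i => ?_⟩
    simpa only [Fin.ofNat_val_eq_self, Fin.val_castSucc, Fin.val_succ] using hs i

/-- A zero-error encoding assigns to each message an input word in such a way that the output block
determines the message; a zero-error code is the set of words of such an encoding. -/
def IsZeroErrorEncoding (ch : FiniteStateChannel X Y S) {m : ℕ} (w : M → Fin m → X) : Prop :=
  ∀ a b y, ch.CanOutput (w a) y → ch.CanOutput (w b) y → a = b

theorem IsZeroErrorCode.isZeroErrorEncoding {m : ℕ} {F : Finset (Fin m → X)}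
    (hF : ch.IsZeroErrorCode F) : ch.IsZeroErrorEncoding (Subtype.val : F → Fin m → X) := by
  intro a b y ha hb
  by_contra hab
  exact hF a a.2 b b.2 (Subtype.coe_ne_coe.2 hab) y ⟨ha, hb⟩

namespace IsZeroErrorEncoding

variable {m : ℕ} {w : M → Fin m → X}

theorem comp_injective (hw : ch.IsZeroErrorEncoding w) {M' : Type*} {f : M' → M}
    (hf : f.Injective) : ch.IsZeroErrorEncoding (w ∘ f) :=
  fun a b y ha hb => hf (hw (f a) (f b) y ha hb)

theorem concat (hw : ch.IsZeroErrorEncoding w) (j : ℕ) :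
    ch.IsZeroErrorEncoding fun (a : Fin j → M) (p : Fin (j * m)) => w (a p.divNat) p.modNat := by
  intro a b y ha hb
  funext i
  have hle : m * i + m ≤ j * m := by
    rw [← Nat.mul_succ, mul_comm j m]
    exact Nat.mul_le_mul_left m i.2
  let pos (k : Fin m) : Fin (j * m) := ⟨m * i + k, by lia⟩
  have hword (c : Fin j → M) : (fun k => w (c (pos k).divNat) (pos k).modNat) = w (c i) := by
    funext k
    have hpos : finProdFinEquiv.symm (pos k) = (i, k) :=
      (Equiv.symm_apply_eq _).2 (Fin.ext (add_comm _ _))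
    rw [finProdFinEquiv_symm_apply, Prod.mk.injEq] at hpos
    rw [hpos.1, hpos.2]
  refine hw (a i) (b i) (y ∘ pos) ?_ ?_
  · exact hword a ▸ ha.block (m * i) m hle
  · exact hword b ▸ hb.block (m * i) m hle

theorem injective [Nonempty S] (hw : ch.IsZeroErrorEncoding w) : w.Injective := by
  intro a b hab
  obtain ⟨y, hy⟩ := ch.exists_canOutput (w a)
  exact hw a b y hy (hab ▸ hy)

theorem exists_isZeroErrorCode [Nonempty S] [Fintype M] (hw : ch.IsZeroErrorEncoding w) :
    ∃ F : Finset (Fin m → X), ch.IsZeroErrorCode F ∧ F.card = Fintype.card M := by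
  refine ⟨Finset.univ.map ⟨w, hw.injective⟩, ?_, Finset.card_map _⟩
  simp only [IsZeroErrorCode, Finset.mem_map, Finset.mem_univ, true_and,
    Function.Embedding.coeFn_mk, forall_exists_index, forall_apply_eq_imp_iff]
  exact fun a b hab y hy => hab (congrArg w (hw a b y hy.1 hy.2))

end IsZeroErrorEncoding

theorem IsZeroErrorCode.exists_isZeroErrorEncoding {m : ℕ} {F : Finset (Fin m → X)}
    (hF : ch.IsZeroErrorCode F) {j : ℕ} [Fintype M] (hM : Fintype.card M ≤ F.card ^ j) :
    ∃ w : M → Fin (j * m) → X, ch.IsZeroErrorEncoding w := by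
  classical
  obtain ⟨φ⟩ := Function.Embedding.nonempty_of_card_le (α := M) (β := Fin j → F) (by simpa using hM)
  exact ⟨_, (hF.isZeroErrorEncoding.concat j).comp_injective φ.injective⟩

section Capacity

variable [Fintype X]

theorem one_lt_card_of_zeroErrorCapacity_pos (h : 0 < ch.zeroErrorCapacity) :
    1 < Fintype.card X := by
  by_contra! hq
  refine h.not_ge (Real.sSup_nonpos ?_)
  rintro _ ⟨n, F, -, rfl⟩
  have hlog : Real.log (Fintype.card X) = 0 := by interval_cases Fintype.card X <;> simp
  simp [Real.logb, hlog]

theorem IsZeroErrorCode.le_zeroErrorCapacity (hq : 1 < Fintype.card X) {n : ℕ}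
    {F : Finset (Fin (n + 1) → X)} (hF : ch.IsZeroErrorCode F) :
    Real.logb (Fintype.card X) F.card / (n + 1) ≤ ch.zeroErrorCapacity := by
  classical
  refine le_csSup ⟨1, ?_⟩ ⟨n, F, hF, rfl⟩
  rintro _ ⟨n, F, -, rfl⟩
  have hq' : (1 : ℝ) < Fintype.card X := by exact_mod_cast hq
  rw [div_le_one (by positivity)]
  rcases F.card.eq_zero_or_pos with hcard | hcard
  · rw [hcard, Nat.cast_zero, Real.logb_zero]
    positivity
  · rw [Real.logb_le_iff_le_rpow hq' (by exact_mod_cast hcard)]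
    exact_mod_cast F.card_le_univ.trans_eq (by simp)

theorem logb_le_zeroErrorCapacity (hq : 1 < Fintype.card X) {κ Δ : ℝ} (hκ : 0 < κ) (hΔ : 0 < Δ)
    (h : ∀ n, ∃ F : Finset (Fin (n + 1) → X), ch.IsZeroErrorCode F ∧ κ * Δ ^ (n + 1) ≤ F.card) :
    Real.logb (Fintype.card X) Δ ≤ ch.zeroErrorCapacity := by
  have hrate (n : ℕ) : Real.logb (Fintype.card X) κ / (n + 1) + Real.logb (Fintype.card X) Δ ≤
      ch.zeroErrorCapacity := by
    obtain ⟨F, hF, hcard⟩ := h n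
    calc Real.logb (Fintype.card X) κ / (n + 1) + Real.logb (Fintype.card X) Δ
        = Real.logb (Fintype.card X) (κ * Δ ^ (n + 1)) / (n + 1) := by
          rw [Real.logb_mul hκ.ne' (pow_pos hΔ _).ne', Real.logb_pow]
          push_cast
          field_simp
      _ ≤ Real.logb (Fintype.card X) F.card / (n + 1) := by
          gcongr
          exact_mod_cast hq
      _ ≤ ch.zeroErrorCapacity := hF.le_zeroErrorCapacity hq
  have hlim : Tendsto (fun n : ℕ => Real.logb (Fintype.card X) κ / ((n : ℝ) + 1) +
      Real.logb (Fintype.card X) Δ) atTop (nhds (0 + Real.logb (Fintype.card X) Δ)) :=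
    (tendsto_const_nhds.div_atTop
      (tendsto_atTop_add_const_right _ _ tendsto_natCast_atTop_atTop)).add_const _
  rw [zero_add] at hlim
  exact le_of_tendsto' hlim hrate

theorem exists_isZeroErrorCode_of_logb_lt (hq : 1 < Fintype.card X) {Δ : ℝ} (hΔ : 1 ≤ Δ)
    (h : Real.logb (Fintype.card X) Δ < ch.zeroErrorCapacity) :
    ∃ γ > Δ, ∃ (n : ℕ) (F : Finset (Fin (n + 1) → X)),
      ch.IsZeroErrorCode F ∧ γ ^ (n + 1) = F.card := by
  have hq' : (1 : ℝ) < Fintype.card X := by exact_mod_cast hq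
  obtain ⟨_, ⟨n, F, hF, rfl⟩, hlt⟩ := exists_lt_of_lt_csSup
    (by exact ⟨_, 0, ∅, fun x hx => absurd hx (Finset.notMem_empty x), rfl⟩) h
  refine ⟨(Fintype.card X : ℝ) ^ (Real.logb (Fintype.card X) F.card / (n + 1)),
    (Real.logb_lt_iff_lt_rpow hq' (by positivity)).1 hlt, n, F, hF, ?_⟩
  have hcard : F.card ≠ 0 := by
    intro hcard
    rw [hcard, Nat.cast_zero, Real.logb_zero, zero_div] at hlt
    exact hlt.not_ge (Real.logb_nonneg hq' hΔ)
  rw [← Real.rpow_natCast, ← Real.rpow_mul (by positivity), Nat.cast_add_one,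
    div_mul_cancel₀ _ (by positivity), Real.rpow_logb (by positivity) hq'.ne' (by positivity)]

end Capacity

end FiniteStateChannel

/-- State of the adaptive quantizer, known to both ends of the channel: `center` approximates the
tracked vector, and the error is believed to be at most `H ^ overflows`, for a fixed `H`, where
`overflows` counts how often this turned out to be wrong. -/
structure QuantizerState (E : Type*) where
  center : E
  overflows : ℕ

namespace QuantizerState

variable {E : Type*} [NormedAddCommGroup E] [NormedSpace ℝ E] (B : E →L[ℝ] E) (H : ℝ)
  (T : Finset E)

section Causality

variable {T}

/-- State update upon a message, which is a net point or, after an overflow, `none`. -/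
def update (σ : QuantizerState E) : Option T → QuantizerState E
  | some c => ⟨B σ.center + H ^ σ.overflows • (c : E), σ.overflows⟩
  | none => ⟨B σ.center, σ.overflows + 1⟩

/-- The state that the receiver computes from the first `k` messages. -/
def receive (μ : ℕ → Option T) : ℕ → QuantizerState E
  | 0 => ⟨0, 0⟩
  | k + 1 => (receive μ k).update B H (μ k)

theorem receive_congr {μ μ' : ℕ → Option T} {k : ℕ} (h : ∀ i < k, μ i = μ' i) :
    receive B H μ k = receive B H μ' k := by
  induction k with
  | zero => rfl
  | succ k ih => rw [receive, receive, ih fun i hi => h i (hi.trans k.lt_succ_self),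
      h k k.lt_succ_self]

end Causality

open Classical in
/-- The message for the vector `x`: a net point approximating the prediction error on the scale
`H ^ overflows`, or `none` if there is no such point. -/
noncomputable def encode (σ : QuantizerState E) (x : E) : Option T :=
  if h : ∃ c : T, ‖B (x - σ.center) - H ^ σ.overflows • (c : E)‖ ≤ H ^ σ.overflows / 2 then
    some h.choose
  else none

/-- The state after the vectors `x 0, …, x (k - 1)` have been encoded. -/
noncomputable def track (x : ℕ → E) : ℕ → QuantizerState E
  | 0 => ⟨0, 0⟩
  | k + 1 => (track x k).update B H ((track x k).encode B H T (x k))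

/-- The message sent for `x k`. -/
noncomputable def message (x : ℕ → E) (k : ℕ) : Option T :=
  (track B H T x k).encode B H T (x k)

theorem receive_message (x : ℕ → E) (k : ℕ) :
    receive B H (message B H T x) k = track B H T x k := by
  induction k with
  | zero => rfl
  | succ k ih => rw [receive, ih, track, message]

theorem track_congr {x x' : ℕ → E} {k : ℕ} (h : ∀ i < k, x i = x' i) :
    track B H T x k = track B H T x' k := by
  induction k with
  | zero => rfl
  | succ k ih => rw [track, track, ih fun i hi => h i (hi.trans k.lt_succ_self),
      h k k.lt_succ_self]

theorem message_congr {x x' : ℕ → E} {k : ℕ} (h : ∀ i ≤ k, x i = x' i) :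
    message B H T x k = message B H T x' k := by
  rw [message, message, track_congr B H T fun i hi => h i hi.le, h k le_rfl]

section ErrorBound

variable {B H T} {σ : QuantizerState E} {x : E}

theorem norm_sub_le_of_encode_eq_some {c : T} (h : σ.encode B H T x = some c) :
    ‖B (x - σ.center) - H ^ σ.overflows • (c : E)‖ ≤ H ^ σ.overflows / 2 := by
  rw [encode] at h
  split_ifs at h with hc
  rw [← Option.some.inj h]
  exact hc.choose_spec

theorem lt_norm_of_encode_eq_none (hH : 0 < H) (hT : IsHalfNet B T)
    (h : σ.encode B H T x = none) : H ^ σ.overflows < ‖x - σ.center‖ := by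
  rw [encode] at h
  split_ifs at h with hc
  by_contra! hle
  set s := H ^ σ.overflows
  have hs : 0 < s := pow_pos hH _
  obtain ⟨y, hyT, hy⟩ := hT (s⁻¹ • (x - σ.center)) (by
    rwa [norm_smul, norm_inv, Real.norm_of_nonneg hs.le, inv_mul_le_one₀ hs])
  refine hc ⟨⟨y, hyT⟩, ?_⟩
  calc ‖B (x - σ.center) - s • y‖
      = ‖s • (B (s⁻¹ • (x - σ.center)) - y)‖ := by rw [map_smul, smul_sub, smul_inv_smul₀ hs.ne']
    _ = s * ‖B (s⁻¹ • (x - σ.center)) - y‖ := by rw [norm_smul, Real.norm_of_nonneg hs.le]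
    _ ≤ s * (1 / 2) := by gcongr
    _ = s / 2 := mul_one_div s 2

/-- Bounds the error after `N` overflows. It satisfies the recursion `b + M * e N ≤ e (N + 1)`, and
yet `e N ≤ (4 * M) ^ N` for large `N`, so that the number of overflows is bounded although the
quantizer does not know the bound `b` on the disturbances. -/
noncomputable def errorBound (M b : ℝ) (N : ℕ) : ℝ := (4 * M) ^ N / 2 + b * (2 * M) ^ N

theorem add_half_le_errorBound {M b : ℝ} (hM : 1 ≤ M) (hb : 0 ≤ b) (N : ℕ) :
    b + (4 * M) ^ N / 2 ≤ errorBound M b N := by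
  rw [errorBound, add_comm]
  gcongr
  exact le_mul_of_one_le_right hb (one_le_pow₀ (by linarith))

theorem add_mul_errorBound_le {M b : ℝ} (hM : 1 ≤ M) (hb : 0 ≤ b) (N : ℕ) :
    b + M * errorBound M b N ≤ errorBound M b (N + 1) := by
  have hb' : b ≤ b * (M * (2 * M) ^ N) :=
    le_mul_of_one_le_right hb (one_le_mul_of_one_le_of_one_le hM (one_le_pow₀ (by linarith)))
  have hpow : 0 ≤ M * (4 * M) ^ N := by positivity
  rw [errorBound, errorBound, pow_succ, pow_succ]
  linarith

theorem errorBound_mono {M b : ℝ} (hM : 1 ≤ M) (hb : 0 ≤ b) : Monotone (errorBound M b) := by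
  intro N N' hN
  unfold errorBound
  gcongr <;> linarith

theorem errorBound_le_pow {M b : ℝ} (hM : 0 ≤ M) {N : ℕ} (hN : b ≤ 2 ^ N / 2) :
    errorBound M b N ≤ (4 * M) ^ N := by
  have hmul : b * (2 * M) ^ N ≤ 2 ^ N / 2 * (2 * M) ^ N := by gcongr
  have hpow : 2 ^ N * (2 * M) ^ N = (4 * M) ^ N := by rw [← mul_pow]; ring
  rw [errorBound]
  linarith

theorem norm_sub_center_update_some_le {b : ℝ} {x' : E} (hx' : ‖x' - B x‖ ≤ b) {c : T}
    (h : σ.encode B H T x = some c) :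
    ‖x' - (σ.update B H (some c)).center‖ ≤ b + H ^ σ.overflows / 2 :=
  calc ‖x' - (B σ.center + H ^ σ.overflows • (c : E))‖
      = ‖(x' - B x) + (B (x - σ.center) - H ^ σ.overflows • (c : E))‖ := by
        rw [map_sub]
        abel_nf
    _ ≤ b + H ^ σ.overflows / 2 := norm_add_le_of_le hx' (norm_sub_le_of_encode_eq_some h)

theorem norm_sub_center_update_none_le {b : ℝ} {x' : E} (hx' : ‖x' - B x‖ ≤ b) :
    ‖x' - (σ.update B H (none : Option T)).center‖ ≤ b + ‖B‖ * ‖x - σ.center‖ :=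
  calc ‖x' - B σ.center‖ = ‖(x' - B x) + B (x - σ.center)‖ := by
        rw [map_sub]
        abel_nf
    _ ≤ b + ‖B‖ * ‖x - σ.center‖ := norm_add_le_of_le hx' (B.le_opNorm _)

/-- Invariant of the quantizer: at most `N` overflows so far, and an error within `errorBound`. -/
def Tracks (σ : QuantizerState E) (M b : ℝ) (N : ℕ) (x : E) : Prop :=
  σ.overflows ≤ N ∧ ‖x - σ.center‖ ≤ errorBound M b σ.overflows

theorem Tracks.update_encode {M b : ℝ} {N : ℕ} (hσ : σ.Tracks M b N x) (hM : 1 ≤ M) (hB : ‖B‖ ≤ M)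
    (hT : IsHalfNet B T) (hb : 0 ≤ b) (hN : b ≤ 2 ^ N / 2) {x' : E} (hx' : ‖x' - B x‖ ≤ b) :
    (σ.update B (4 * M) (σ.encode B (4 * M) T x)).Tracks M b N x' := by
  obtain ⟨hσN, hσ⟩ := hσ
  cases hmsg : σ.encode B (4 * M) T x with
  | some c =>
    exact ⟨hσN, (norm_sub_center_update_some_le hx' hmsg).trans (add_half_le_errorBound hM hb _)⟩
  | none =>
    have hlt := lt_norm_of_encode_eq_none (by linarith) hT hmsg
    have hne : σ.overflows ≠ N := by
      intro heq
      rw [heq] at hσ hlt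
      exact (hlt.trans_le hσ).not_ge (errorBound_le_pow (by linarith) hN)
    refine ⟨lt_of_le_of_ne hσN hne, ?_⟩
    calc ‖x' - (σ.update B (4 * M) none).center‖
        ≤ b + ‖B‖ * ‖x - σ.center‖ := norm_sub_center_update_none_le hx'
      _ ≤ b + M * errorBound M b σ.overflows := by gcongr
      _ ≤ errorBound M b (σ.overflows + 1) := add_mul_errorBound_le hM hb _

theorem exists_norm_sub_center_track_le {M : ℝ} (hM : 1 ≤ M) (hB : ‖B‖ ≤ M)
    (hT : IsHalfNet B T) (b : ℝ) :
    ∃ β, ∀ x : ℕ → E, ‖x 0‖ ≤ b → IsPseudoOrbit B b x →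
      ∀ k, ‖x k - (track B (4 * M) T x k).center‖ ≤ β := by
  obtain ⟨N, hN⟩ := pow_unbounded_of_one_lt (2 * b) (one_lt_two (α := ℝ))
  refine ⟨errorBound M b N, fun x hx₀ hx k => ?_⟩
  have hb : 0 ≤ b := (norm_nonneg _).trans hx₀
  suffices h : (track B (4 * M) T x k).Tracks M b N (x k) from
    h.2.trans (errorBound_mono hM hb h.1)
  induction k with
  | zero =>
    refine ⟨N.zero_le, ?_⟩
    have hzero := add_half_le_errorBound hM hb 0
    rw [pow_zero] at hzero
    rw [track, sub_zero]
    linarith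
  | succ k ih =>
    exact ih.update_encode hM hB hT hb (by linarith) (hx k)

end ErrorBound

end QuantizerState

section Observer

variable {nx ny : ℕ} {A : Matrix (Fin nx) (Fin nx) ℝ} {C : Matrix (Fin ny) (Fin nx) ℝ}

theorem isPseudoOrbit_plantState (A : Matrix (Fin nx) (Fin nx) ℝ) (x₀ : Fin nx → ℝ)
    {v : ℕ → Fin nx → ℝ} {b : ℝ} (hv : ∀ t, ‖v t‖ ≤ b) :
    IsPseudoOrbit (mulVecCLM A) b (plantState A x₀ v) := fun t => by
  simpa only [plantState, mulVecCLM_apply, add_sub_cancel_left] using hv t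

/-- The first `N` outputs of the undisturbed system, as a function of its initial state. -/
noncomputable def outputMap (A : Matrix (Fin nx) (Fin nx) ℝ) (C : Matrix (Fin ny) (Fin nx) ℝ)
    (N : ℕ) : (Fin nx → ℝ) →ₗ[ℝ] (Fin N → Fin ny → ℝ) :=
  LinearMap.pi fun k => C.mulVecLin ∘ₗ (A ^ (k : ℕ)).mulVecLin

theorem mem_ker_outputMap {N : ℕ} {x : Fin nx → ℝ} :
    x ∈ (outputMap A C N).ker ↔ ∀ k < N, C.mulVec ((A ^ k).mulVec x) = 0 := by
  rw [LinearMap.mem_ker, funext_iff]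
  exact Fin.forall_iff

theorem ker_outputMap_antitone : Antitone fun N => (outputMap A C N).ker := by
  intro N N' hN x hx
  rw [mem_ker_outputMap] at hx ⊢
  exact fun k hk => hx k (hk.trans_le hN)

theorem IsObservable.exists_leftInverse_outputMap (h : IsObservable C A) :
    ∃ (N : ℕ) (G : (Fin N → Fin ny → ℝ) →L[ℝ] (Fin nx → ℝ)), ∀ x, G (outputMap A C N x) = x := by
  obtain ⟨N, hN⟩ := IsArtinian.monotone_stabilizes
    ⟨fun N => OrderDual.toDual (outputMap A C N).ker, ker_outputMap_antitone.dual_right⟩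
  have hker : (outputMap A C N).ker = ⊥ := by
    rw [eq_bot_iff]
    intro x hx
    refine h (funext fun k => ?_)
    have hstable : (outputMap A C N).ker = (outputMap A C (max N (k + 1))).ker :=
      hN _ (le_max_left _ _)
    rw [hstable, mem_ker_outputMap] at hx
    simpa using hx k (lt_max_of_lt_right k.lt_succ_self)
  obtain ⟨G, hG⟩ := (outputMap A C N).exists_leftInverse_of_injective hker
  exact ⟨N, G.toContinuousLinearMap, LinearMap.congr_fun hG⟩

/-- The estimate of the state at time `t` from the outputs before time `t`: the state at time
`t - N` is reconstructed by `G` from the next `N` outputs and propagated. It is set to `0` until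
enough outputs are available. -/
def observer (A : Matrix (Fin nx) (Fin nx) ℝ) {N : ℕ}
    (G : (Fin N → Fin ny → ℝ) →L[ℝ] (Fin nx → ℝ)) (y : ℕ → Fin ny → ℝ) (t : ℕ) : Fin nx → ℝ :=
  if N ≤ t then (A ^ N).mulVec (G fun k => y (t - N + k)) else 0

variable {N : ℕ} {G : (Fin N → Fin ny → ℝ) →L[ℝ] (Fin nx → ℝ)}

theorem observer_congr {y y' : ℕ → Fin ny → ℝ} {t : ℕ} (h : ∀ i < t, y i = y' i) :
    observer A G y t = observer A G y' t := by
  rw [observer, observer]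
  split_ifs with hN
  · congr 2
    exact funext fun k => h _ (by lia)
  · rfl

theorem exists_norm_reconstruction_sub_le (hG : ∀ x, G (outputMap A C N x) = x) (b : ℝ) :
    ∃ ε, ∀ x₀ v w, (∀ t, ‖v t‖ ≤ b) → (∀ t, ‖w t‖ ≤ b) →
      ∀ s, ‖G (fun k => plantOutput A C x₀ v w (s + k)) - plantState A x₀ v s‖ ≤ ε := by
  let L := C.mulVecLin.toContinuousLinearMap
  refine ⟨‖G‖ * (‖L‖ * (b * ∑ i ∈ Finset.range N, ‖mulVecCLM A ^ i‖) + b),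
    fun x₀ v w hv hw s => ?_⟩
  have hb : 0 ≤ b := (norm_nonneg _).trans (hv 0)
  conv_lhs => rw [← hG (plantState A x₀ v s), ← map_sub]
  refine G.le_opNorm_of_le ((pi_norm_le_iff_of_nonneg (by positivity)).2 fun k => ?_)
  have hdrift : ‖plantState A x₀ v (s + k) - (A ^ (k : ℕ)).mulVec (plantState A x₀ v s)‖ ≤
      b * ∑ i ∈ Finset.range N, ‖mulVecCLM A ^ i‖ := by
    rw [← mulVecCLM_pow_apply]
    refine ((isPseudoOrbit_plantState A x₀ hv).norm_sub_pow_apply_le s k).trans ?_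
    gcongr
    exact k.2.le
  calc ‖plantOutput A C x₀ v w (s + k) - outputMap A C N (plantState A x₀ v s) k‖
      = ‖L (plantState A x₀ v (s + k) - (A ^ (k : ℕ)).mulVec (plantState A x₀ v s))
          + w (s + k)‖ := by
        rw [map_sub, sub_add_eq_add_sub]
        rfl
    _ ≤ ‖L‖ * (b * ∑ i ∈ Finset.range N, ‖mulVecCLM A ^ i‖) + b :=
        norm_add_le_of_le (L.le_opNorm_of_le hdrift) (hw _)

theorem exists_norm_observer_sub_le (hG : ∀ x, G (outputMap A C N x) = x) (b : ℝ) :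
    ∃ β, ∀ x₀ v w, ‖x₀‖ ≤ b → (∀ t, ‖v t‖ ≤ b) → (∀ t, ‖w t‖ ≤ b) →
      ∀ t, ‖observer A G (plantOutput A C x₀ v w) t - plantState A x₀ v t‖ ≤ β := by
  obtain ⟨ε, hε⟩ := exists_norm_reconstruction_sub_le hG b
  refine ⟨(max ε b + b) * ∑ i ∈ Finset.range (N + 1), ‖mulVecCLM A ^ i‖,
    fun x₀ v w hx₀ hv hw t => ?_⟩
  have horbit := isPseudoOrbit_plantState A x₀ hv
  rw [observer]
  split_ifs with hN
  · obtain ⟨s, rfl⟩ := Nat.exists_eq_add_of_le' hN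
    rw [Nat.add_sub_cancel, ← mulVecCLM_pow_apply]
    refine (horbit.norm_pow_apply_sub_le _ s le_rfl).trans ?_
    gcongr
    exact (hε x₀ v w hv hw s).trans (le_max_left _ _)
  · have hzero := horbit.norm_pow_apply_sub_le 0 0 (not_le.1 hN).le
    rw [map_zero, zero_add] at hzero
    refine hzero.trans ?_
    rw [zero_sub, norm_neg]
    gcongr
    exact hx₀.trans (le_max_right _ _)

end Observer

section BlockCoding

/-- The extension of a finite sequence that repeats the last entry. -/
def holdLast {α : Type*} {t : ℕ} (y : Fin (t + 1) → α) (i : ℕ) : α :=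
  y ⟨min i t, Nat.lt_succ_of_le (min_le_right i t)⟩

theorem holdLast_of_le {α : Type*} (y : ℕ → α) {i t : ℕ} (hi : i ≤ t) :
    holdLast (fun j : Fin (t + 1) => y j) i = y i :=
  congrArg y (min_eq_left hi)

variable {X Y S M : Type*} [Nonempty M] {ch : FiniteStateChannel X Y S} {n : ℕ}
  {w : M → Fin n → X}

/-- The decoder of a zero-error code: a message that can result in the given output block, if there
is one. -/
noncomputable def FiniteStateChannel.decode (ch : FiniteStateChannel X Y S) (w : M → Fin n → X)
    (y : Fin n → Y) : M :=
  Classical.epsilon fun a => ch.CanOutput (w a) y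

theorem FiniteStateChannel.IsZeroErrorEncoding.decode_eq (hw : ch.IsZeroErrorEncoding w) {a : M}
    {y : Fin n → Y} (h : ch.CanOutput (w a) y) : ch.decode w y = a :=
  hw _ _ y (Classical.epsilon_spec (p := fun a => ch.CanOutput (w a) y) ⟨a, h⟩) h

variable {nx ny : ℕ} [NeZero n]

namespace CoderEstimator

/-- The coder-estimator that sends the messages `msg y k` computed from the plant outputs, one
codeword of length `n` per message, and estimates by applying `est` to the decoded messages. -/
noncomputable def ofBlockCode (ch : FiniteStateChannel X Y S) (w : M → Fin n → X)
    (msg : (ℕ → Fin ny → ℝ) → ℕ → M) (est : (ℕ → M) → ℕ → Fin nx → ℝ) :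
    CoderEstimator nx ny X Y where
  coder t y := w (msg (holdLast y) (t / n)) (Fin.ofNat n t)
  estimator t r := est (fun k => ch.decode w fun i => holdLast r (k * n + i)) (t + 1)

variable {msg : (ℕ → Fin ny → ℝ) → ℕ → M} {est : (ℕ → M) → ℕ → Fin nx → ℝ}

theorem input_ofBlockCode (hmsg : ∀ y y' k, (∀ i ≤ k * n, y i = y' i) → msg y k = msg y' k)
    (y : ℕ → Fin ny → ℝ) (k : ℕ) (i : Fin n) :
    (ofBlockCode ch w msg est).input y (k * n + i) = w (msg y k) i := by
  have hdiv : (k * n + i) / n = k := by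
    rw [add_comm, Nat.add_mul_div_right _ _ i.pos, Nat.div_eq_of_lt i.2, zero_add]
  have hmod : Fin.ofNat n (k * n + i) = i :=
    Fin.ext (by rw [Fin.val_ofNat, add_comm, Nat.add_mul_mod_self_right, Nat.mod_eq_of_lt i.2])
  calc (ofBlockCode ch w msg est).input y (k * n + i)
      = w (msg (holdLast fun j : Fin (k * n + i + 1) => y j) ((k * n + i) / n))
          (Fin.ofNat n (k * n + i)) := rfl
    _ = w (msg y k) i := by
        rw [hdiv, hmod, hmsg _ y k fun j hj => holdLast_of_le y (hj.trans (Nat.le_add_right _ _))]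

theorem estimate_ofBlockCode (hw : ch.IsZeroErrorEncoding w)
    (hmsg : ∀ y y' k, (∀ i ≤ k * n, y i = y' i) → msg y k = msg y' k)
    (hest : ∀ μ μ' t, (∀ k, (k + 1) * n ≤ t → μ k = μ' k) → est μ t = est μ' t)
    {y : ℕ → Fin ny → ℝ} {r : ℕ → Y}
    (hr : ch.CanOutputSeq ((ofBlockCode ch w msg est).input y) r) (t : ℕ) :
    (ofBlockCode ch w msg est).estimate r (t + 1) = est (msg y) (t + 1) := by
  refine hest _ _ _ fun k hk => hw.decode_eq ?_
  have hreceived : (fun i : Fin n => holdLast (fun j : Fin (t + 1) => r j) (k * n + i)) =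
      fun i : Fin n => r (k * n + i) :=
    funext fun i => holdLast_of_le r (by lia)
  have hblock := hr.block (k * n) n
  simp only [input_ofBlockCode hmsg] at hblock
  exact hreceived ▸ hblock

end CoderEstimator

end BlockCoding

section Necessity

variable {nx ny : ℕ} {A : Matrix (Fin nx) (Fin nx) ℝ}

theorem plantState_zero_noise (A : Matrix (Fin nx) (Fin nx) ℝ) (x₀ : Fin nx → ℝ) (t : ℕ) :
    plantState A x₀ 0 t = (A ^ t).mulVec x₀ := by
  induction t with
  | zero => rw [plantState, pow_zero, Matrix.one_mulVec]
  | succ t ih => rw [plantState, ih, Matrix.mulVec_mulVec, ← pow_succ', Pi.zero_apply, add_zero]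

theorem isAdmissibleNoise_singleton_zero (k : ℕ) :
    IsAdmissibleNoise ({0} : Set (ℕ → Fin k → ℝ)) :=
  ⟨⟨0, by simp⟩, rfl⟩

namespace UnitCircleSplitting

variable (σ : UnitCircleSplitting A)

/-- The projection of the state to its unstable coordinates. -/
noncomputable def unstablePart : (Fin nx → ℝ) →L[ℝ] (Fin σ.unstableDim → ℝ) :=
  (LinearMap.fst ℝ _ _ ∘ₗ σ.coords.toLinearMap).toContinuousLinearMap

/-- The projection of the state to its stable coordinates. -/
noncomputable def stablePart : (Fin nx → ℝ) →L[ℝ] (Fin σ.stableDim → ℝ) :=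
  (LinearMap.snd ℝ _ _ ∘ₗ σ.coords.toLinearMap).toContinuousLinearMap

/-- The state with given unstable coordinates and vanishing stable coordinates. -/
noncomputable def lift : (Fin σ.unstableDim → ℝ) →L[ℝ] (Fin nx → ℝ) :=
  (σ.coords.symm.toLinearMap ∘ₗ LinearMap.inl ℝ _ _).toContinuousLinearMap

theorem coords_lift (u : Fin σ.unstableDim → ℝ) : σ.coords (σ.lift u) = (u, 0) :=
  σ.coords.apply_symm_apply (u, 0)

theorem unstablePart_lift (u : Fin σ.unstableDim → ℝ) : σ.unstablePart (σ.lift u) = u :=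
  congrArg Prod.fst (σ.coords_lift u)

theorem unstablePart_mulVec (x : Fin nx → ℝ) :
    σ.unstablePart (A.mulVec x) = σ.unstable.mulVec (σ.unstablePart x) :=
  congrArg Prod.fst (σ.coords_mulVec x)

theorem stablePart_mulVec (x : Fin nx → ℝ) :
    σ.stablePart (A.mulVec x) = σ.stable.mulVec (σ.stablePart x) :=
  congrArg Prod.snd (σ.coords_mulVec x)

theorem unstablePart_pow_mulVec (t : ℕ) (x : Fin nx → ℝ) :
    σ.unstablePart ((A ^ t).mulVec x) = (σ.unstable ^ t).mulVec (σ.unstablePart x) := by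
  induction t with
  | zero => simp only [pow_zero, Matrix.one_mulVec]
  | succ t ih => rw [pow_succ', ← Matrix.mulVec_mulVec, σ.unstablePart_mulVec, ih,
      Matrix.mulVec_mulVec, ← pow_succ']

theorem exists_norm_lift_sub_le :
    ∃ c, 0 ≤ c ∧ ∀ z x, ‖σ.lift z - x‖ ≤ c * max ‖z - σ.unstablePart x‖ ‖σ.stablePart x‖ := by
  let Φ := σ.coords.symm.toLinearMap.toContinuousLinearMap
  refine ⟨‖Φ‖, norm_nonneg _, fun z x => ?_⟩
  have hcoords : σ.lift z - x = Φ (z - σ.unstablePart x, -σ.stablePart x) := by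
    refine σ.coords.eq_symm_apply.2 ?_
    rw [map_sub, σ.coords_lift]
    exact Prod.ext rfl (zero_sub _)
  rw [hcoords, ← norm_neg (σ.stablePart x)]
  exact Φ.le_opNorm _

theorem exists_isSeparated_pow_mulVec {l : ℝ} (hl : 0 < l) (β : ℝ) :
    ∃ κ > 0, ∀ n, ∃ T : Finset (Fin nx → ℝ), (∀ x ∈ T, ‖x‖ ≤ l) ∧
      (T : Set (Fin nx → ℝ)).Pairwise (fun x x' => β < ‖(A ^ n).mulVec (x - x')‖) ∧
        κ * ‖σ.unstable.det‖ ^ n ≤ T.card := by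
  let ρ := l / (‖σ.lift‖ + 1)
  let δ := ‖σ.unstablePart‖ * |β| + 1
  have hρ : 0 < ρ := by positivity
  have hδ : 0 < δ := by positivity
  have hinj : Function.Injective σ.lift := Function.LeftInverse.injective σ.unstablePart_lift
  refine ⟨(ρ / δ) ^ σ.unstableDim, by positivity, fun n => ?_⟩
  obtain ⟨T, hTρ, hTδ, hcard⟩ := exists_isSeparated_image (mulVecCLM (σ.unstable ^ n)) hρ.le hδ
  refine ⟨T.map ⟨σ.lift, hinj⟩, ?_, ?_, ?_⟩
  · rw [Finset.forall_mem_map]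
    intro u hu
    calc ‖σ.lift u‖ ≤ (‖σ.lift‖ + 1) * ρ :=
          σ.lift.le_of_opNorm_le_of_le (lt_add_one _).le (hTρ u hu)
      _ = l := mul_div_cancel₀ _ (by positivity)
  · rw [Finset.coe_map, Function.Embedding.coeFn_mk, hinj.injOn.pairwise_image]
    intro u hu u' hu' hne
    by_contra! hnear
    refine (hTδ hu hu' hne).not_ge ?_
    calc ‖mulVecCLM (σ.unstable ^ n) (u - u')‖
        = ‖σ.unstablePart ((A ^ n).mulVec (σ.lift u - σ.lift u'))‖ := by
          rw [σ.unstablePart_pow_mulVec, ← map_sub, σ.unstablePart_lift, mulVecCLM_apply]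
      _ ≤ ‖σ.unstablePart‖ * |β| :=
          σ.unstablePart.le_opNorm_of_le (hnear.trans (le_abs_self β))
      _ ≤ δ := (lt_add_one _).le
  · rwa [det_mulVecCLM, Matrix.det_pow, abs_pow, Module.finrank_fin_fun, mul_comm,
      ← Real.norm_eq_abs, ← Finset.card_map] at hcard

end UnitCircleSplitting

variable {X Y S : Type*} {C : Matrix (Fin ny) (Fin nx) ℝ} {ch : FiniteStateChannel X Y S}
  {K : CoderEstimator nx ny X Y}

theorem CoderEstimator.isZeroErrorEncoding_input {T : Set (Fin nx → ℝ)} {β : ℝ} {t : ℕ}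
    (hK : ∀ x ∈ T, ∀ r : ℕ → Y, ch.CanOutputSeq (K.input (plantOutput A C x 0 0)) r →
      ‖K.estimate r (t + 1) - plantState A x 0 (t + 1)‖ ≤ β)
    (hT : T.Pairwise fun x x' => 2 * β < ‖(A ^ (t + 1)).mulVec (x - x')‖) :
    ch.IsZeroErrorEncoding fun (x : T) (i : Fin (t + 1)) => K.input (plantOutput A C x 0 0) i := by
  intro x x' y hy hy'
  obtain ⟨r, hr, hry⟩ := hy.exists_extension
  obtain ⟨r', hr', hry'⟩ := hy'.exists_extension
  have hsame : K.estimate r (t + 1) = K.estimate r' (t + 1) :=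
    congrArg (K.estimator t) (funext fun i => (hry i).trans (hry' i).symm)
  have herror := hK x x.2 r hr
  have herror' := hK x' x'.2 r' hr'
  rw [plantState_zero_noise] at herror herror'
  rw [hsame, norm_sub_rev] at herror
  by_contra hne
  refine (hT x.2 x'.2 (Subtype.coe_ne_coe.2 hne)).not_ge ?_
  rw [Matrix.mulVec_sub, two_mul]
  exact (norm_sub_le_norm_sub_add_norm_sub _ _ _).trans (add_le_add herror herror')

theorem CoderEstimator.UniformlyBoundedErrors.linEntropy_le [Fintype X] [Nonempty S]
    (hq : 1 < Fintype.card X) (hK : K.UniformlyBoundedErrors A C ch) :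
    linEntropy (Fintype.card X) A ≤ ch.zeroErrorCapacity := by
  obtain ⟨σ⟩ := UnitCircleSplitting.nonempty A
  obtain ⟨l, hl, hbound⟩ :=
    hK _ _ (isAdmissibleNoise_singleton_zero nx) (isAdmissibleNoise_singleton_zero ny)
  obtain ⟨β, hβ⟩ := hbound _ subset_rfl
  obtain ⟨κ, hκ, hsep⟩ := σ.exists_isSeparated_pow_mulVec hl (2 * β)
  rw [σ.linEntropy_eq]
  refine FiniteStateChannel.logb_le_zeroErrorCapacity hq hκ
    (one_pos.trans_le σ.one_le_norm_det_unstable) fun n => ?_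
  obtain ⟨T, hTl, hT, hcard⟩ := hsep (n + 1)
  have hw := CoderEstimator.isZeroErrorEncoding_input (T := T) (C := C) (fun x hx r hr =>
    hβ x (mem_closedBall_zero_iff.2 (hTl x hx)) 0 rfl 0 rfl r hr (n + 1)) hT
  obtain ⟨F, hF, hFT⟩ := hw.exists_isZeroErrorCode
  exact ⟨F, hF, by rwa [hFT.trans (Fintype.card_coe T)]⟩

end Necessity

section Sufficiency

variable {nx ny : ℕ} {A : Matrix (Fin nx) (Fin nx) ℝ} {C : Matrix (Fin ny) (Fin nx) ℝ} {N : ℕ}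
  {G : (Fin N → Fin ny → ℝ) →L[ℝ] (Fin nx → ℝ)}

namespace UnitCircleSplitting

variable (σ : UnitCircleSplitting A)

theorem exists_norm_stablePart_plantState_le (b : ℝ) :
    ∃ β, ∀ x₀ v, ‖x₀‖ ≤ b → (∀ t, ‖v t‖ ≤ b) → ∀ t, ‖σ.stablePart (plantState A x₀ v t)‖ ≤ β := by
  refine ⟨(‖σ.stablePart‖ * b + ‖σ.stablePart‖ * b) * ∑' i, ‖mulVecCLM σ.stable ^ i‖,
    fun x₀ v hx₀ hv t => ?_⟩
  have horbit : IsPseudoOrbit (mulVecCLM σ.stable) (‖σ.stablePart‖ * b)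
      fun t => σ.stablePart (plantState A x₀ v t) :=
    (isPseudoOrbit_plantState A x₀ hv).map _ σ.stablePart_mulVec
  refine (horbit.norm_le_of_summable (summable_norm_mulVecCLM_pow σ.norm_lt_one) t).trans ?_
  gcongr
  exact σ.stablePart.le_opNorm_of_le hx₀

/-- The unstable coordinates of the observed state, sampled every `n` steps. -/
noncomputable def observedUnstablePart (G : (Fin N → Fin ny → ℝ) →L[ℝ] (Fin nx → ℝ)) (n : ℕ)
    (y : ℕ → Fin ny → ℝ) (k : ℕ) : Fin σ.unstableDim → ℝ :=
  σ.unstablePart (observer A G y (k * n))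

theorem observedUnstablePart_congr {n k : ℕ} {y y' : ℕ → Fin ny → ℝ}
    (h : ∀ i ≤ k * n, y i = y' i) :
    σ.observedUnstablePart G n y k = σ.observedUnstablePart G n y' k :=
  congrArg σ.unstablePart (observer_congr fun i hi => h i hi.le)

theorem exists_norm_observedUnstablePart_sub_le (hG : ∀ x, G (outputMap A C N x) = x) (n : ℕ)
    (b : ℝ) :
    ∃ ε, ∀ x₀ v w, ‖x₀‖ ≤ b → (∀ t, ‖v t‖ ≤ b) → (∀ t, ‖w t‖ ≤ b) →
      ∀ k, ‖σ.observedUnstablePart G n (plantOutput A C x₀ v w) k -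
        σ.unstablePart (plantState A x₀ v (k * n))‖ ≤ ε := by
  obtain ⟨β, hβ⟩ := exists_norm_observer_sub_le hG b
  refine ⟨‖σ.unstablePart‖ * β, fun x₀ v w hx₀ hv hw k => ?_⟩
  rw [observedUnstablePart, ← map_sub]
  exact σ.unstablePart.le_opNorm_of_le (hβ x₀ v w hx₀ hv hw _)

theorem exists_isPseudoOrbit_observedUnstablePart (hG : ∀ x, G (outputMap A C N x) = x) (n : ℕ)
    (b : ℝ) :
    ∃ β, ∀ x₀ v w, ‖x₀‖ ≤ b → (∀ t, ‖v t‖ ≤ b) → (∀ t, ‖w t‖ ≤ b) →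
      ‖σ.observedUnstablePart G n (plantOutput A C x₀ v w) 0‖ ≤ β ∧
        IsPseudoOrbit (mulVecCLM σ.unstable ^ n) β
          (σ.observedUnstablePart G n (plantOutput A C x₀ v w)) := by
  obtain ⟨ε, hε⟩ := σ.exists_norm_observedUnstablePart_sub_le hG n b
  refine ⟨max (ε + ‖σ.unstablePart‖ * b) _, fun x₀ v w hx₀ hv hw =>
    ⟨le_max_of_le_left ?_, fun k => le_max_of_le_right (IsPseudoOrbit.of_norm_sub_le
      (((isPseudoOrbit_plantState A x₀ hv).map _ σ.unstablePart_mulVec).sample n)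
      (hε x₀ v w hx₀ hv hw) k)⟩⟩
  have hinit := hε x₀ v w hx₀ hv hw 0
  rw [zero_mul] at hinit
  exact (norm_le_norm_sub_add _ _).trans (add_le_add hinit (σ.unstablePart.le_opNorm_of_le hx₀))

/-- The quantizer messages for the observed unstable coordinates. -/
noncomputable def messages (G : (Fin N → Fin ny → ℝ) →L[ℝ] (Fin nx → ℝ)) (n : ℕ) (H : ℝ)
    (T : Finset (Fin σ.unstableDim → ℝ)) (y : ℕ → Fin ny → ℝ) : ℕ → Option T :=
  QuantizerState.message (mulVecCLM σ.unstable ^ n) H T (σ.observedUnstablePart G n y)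

/-- The estimate of the plant state from the received quantizer messages: stable coordinates are
estimated by `0`, and between the sampling times the estimate is propagated by `A`. -/
noncomputable def stateEstimate (n : ℕ) (H : ℝ) {T : Finset (Fin σ.unstableDim → ℝ)}
    (μ : ℕ → Option T) (t : ℕ) : Fin nx → ℝ :=
  (A ^ (t % n)).mulVec
    (σ.lift (QuantizerState.receive (mulVecCLM σ.unstable ^ n) H μ (t / n)).center)

variable {n : ℕ} {H : ℝ} {T : Finset (Fin σ.unstableDim → ℝ)}

theorem messages_congr {y y' : ℕ → Fin ny → ℝ} {k : ℕ} (h : ∀ i ≤ k * n, y i = y' i) :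
    σ.messages G n H T y k = σ.messages G n H T y' k :=
  QuantizerState.message_congr _ _ _ fun _ hi =>
    σ.observedUnstablePart_congr fun j hj => h j (hj.trans (Nat.mul_le_mul_right n hi))

theorem stateEstimate_congr {μ μ' : ℕ → Option T} {t : ℕ}
    (h : ∀ k, (k + 1) * n ≤ t → μ k = μ' k) :
    σ.stateEstimate n H μ t = σ.stateEstimate n H μ' t := by
  rw [stateEstimate, stateEstimate, QuantizerState.receive_congr _ _ fun i hi =>
    h i ((Nat.mul_le_mul_right n hi).trans (Nat.div_mul_le_self t n))]

theorem exists_norm_lift_center_sub_plantState_le {M : ℝ} (hG : ∀ x, G (outputMap A C N x) = x)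
    (hM : 1 ≤ M) (hAM : ‖mulVecCLM σ.unstable ^ n‖ ≤ M)
    (hT : IsHalfNet (mulVecCLM σ.unstable ^ n) T) (b : ℝ) :
    ∃ β, ∀ x₀ v w, ‖x₀‖ ≤ b → (∀ t, ‖v t‖ ≤ b) → (∀ t, ‖w t‖ ≤ b) →
      ∀ k, ‖σ.lift (QuantizerState.receive (mulVecCLM σ.unstable ^ n) (4 * M)
        (σ.messages G n (4 * M) T (plantOutput A C x₀ v w)) k).center -
          plantState A x₀ v (k * n)‖ ≤ β := by
  obtain ⟨ε, hε⟩ := σ.exists_norm_observedUnstablePart_sub_le hG n b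
  obtain ⟨βo, hβo⟩ := σ.exists_isPseudoOrbit_observedUnstablePart hG n b
  obtain ⟨βq, hβq⟩ := QuantizerState.exists_norm_sub_center_track_le hM hAM hT βo
  obtain ⟨βs, hβs⟩ := σ.exists_norm_stablePart_plantState_le b
  obtain ⟨c, hc, hlift⟩ := σ.exists_norm_lift_sub_le
  refine ⟨c * max (βq + ε) βs, fun x₀ v w hx₀ hv hw k => (hlift _ _).trans ?_⟩
  obtain ⟨hinit, horbit⟩ := hβo x₀ v w hx₀ hv hw
  have hcenter := hβq _ hinit horbit k
  rw [norm_sub_rev] at hcenter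
  rw [messages, QuantizerState.receive_message]
  gcongr
  · exact (norm_sub_le_norm_sub_add_norm_sub _ _ _).trans
      (add_le_add hcenter (hε x₀ v w hx₀ hv hw k))
  · exact hβs x₀ v hx₀ hv (k * n)

theorem exists_norm_stateEstimate_sub_plantState_le [NeZero n] {M : ℝ}
    (hG : ∀ x, G (outputMap A C N x) = x)
    (hM : 1 ≤ M) (hAM : ‖mulVecCLM σ.unstable ^ n‖ ≤ M)
    (hT : IsHalfNet (mulVecCLM σ.unstable ^ n) T) (b : ℝ) :
    ∃ β, ∀ x₀ v w, ‖x₀‖ ≤ b → (∀ t, ‖v t‖ ≤ b) → (∀ t, ‖w t‖ ≤ b) →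
      ∀ t, ‖σ.stateEstimate n (4 * M) (σ.messages G n (4 * M) T (plantOutput A C x₀ v w)) t -
        plantState A x₀ v t‖ ≤ β := by
  obtain ⟨β, hβ⟩ := σ.exists_norm_lift_center_sub_plantState_le hG hM hAM hT b
  refine ⟨(β + b) * ∑ i ∈ Finset.range (n + 1), ‖mulVecCLM A ^ i‖,
    fun x₀ v w hx₀ hv hw t => ?_⟩
  have hdrift := (isPseudoOrbit_plantState A x₀ hv).norm_pow_apply_sub_le
    (σ.lift (QuantizerState.receive (mulVecCLM σ.unstable ^ n) (4 * M)
      (σ.messages G n (4 * M) T (plantOutput A C x₀ v w)) (t / n)).center)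
    (t / n * n) (Nat.mod_lt t (NeZero.pos n)).le
  rw [Nat.div_add_mod', mulVecCLM_pow_apply] at hdrift
  refine hdrift.trans ?_
  gcongr
  exact hβ x₀ v w hx₀ hv hw (t / n)

end UnitCircleSplitting

variable {X Y S : Type*} {ch : FiniteStateChannel X Y S}

theorem CoderEstimator.UniformlyBoundedErrors.of_forall_exists_norm_le
    {K : CoderEstimator nx ny X Y}
    (hK : ∀ b, ∃ β, ∀ x₀ v w r, ‖x₀‖ ≤ b → (∀ t, ‖v t‖ ≤ b) → (∀ t, ‖w t‖ ≤ b) →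
      ch.CanOutputSeq (K.input (plantOutput A C x₀ v w)) r →
        ∀ t, ‖K.estimate r t - plantState A x₀ v t‖ ≤ β) :
    K.UniformlyBoundedErrors A C ch := by
  rintro NV NW ⟨⟨bv, hbv⟩, -⟩ ⟨⟨bw, hbw⟩, -⟩
  obtain ⟨β, hβ⟩ := hK (max 1 (max bv bw))
  refine ⟨1, one_pos, fun I hI => ⟨β, fun x₀ hx₀ v hv w hw r hr => hβ x₀ v w r ?_ ?_ ?_ hr⟩⟩
  · exact (mem_closedBall_zero_iff.1 (hI hx₀)).trans (le_max_left _ _)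
  · exact fun t => (hbv v hv t).trans (le_max_of_le_right (le_max_left _ _))
  · exact fun t => (hbw w hw t).trans (le_max_of_le_right (le_max_right _ _))

theorem UnitCircleSplitting.exists_uniformlyBoundedErrors (σ : UnitCircleSplitting A)
    (hG : ∀ x, G (outputMap A C N x) = x) {n : ℕ} [NeZero n] {T : Finset (Fin σ.unstableDim → ℝ)}
    (hT : IsHalfNet (mulVecCLM σ.unstable ^ n) T) {w : Option T → Fin n → X}
    (hw : ch.IsZeroErrorEncoding w) :
    ∃ K : CoderEstimator nx ny X Y, K.UniformlyBoundedErrors A C ch := by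
  let H := 4 * max 1 ‖mulVecCLM σ.unstable ^ n‖
  refine ⟨.ofBlockCode ch w (σ.messages G n H T) (σ.stateEstimate n H), .of_forall_exists_norm_le
    fun b => ?_⟩
  obtain ⟨β, hβ⟩ := σ.exists_norm_stateEstimate_sub_plantState_le hG (le_max_left _ _)
    (le_max_right _ _) hT b
  refine ⟨max b β, fun x₀ v w' r hx₀ hv hw' hr t => ?_⟩
  cases t with
  | zero =>
    rw [CoderEstimator.estimate, plantState, zero_sub, norm_neg]
    exact hx₀.trans (le_max_left _ _)
  | succ t =>
    rw [CoderEstimator.estimate_ofBlockCode hw (fun _ _ _ => σ.messages_congr)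
      (fun _ _ _ => σ.stateEstimate_congr) hr]
    exact (hβ x₀ v w' hx₀ hv hw' (t + 1)).trans (le_max_right _ _)

theorem exists_uniformlyBoundedErrors_of_linEntropy_lt [Fintype X] (hq : 1 < Fintype.card X)
    (hobs : IsObservable C A)
    (hlt : linEntropy (Fintype.card X) A < ch.zeroErrorCapacity) :
    ∃ K : CoderEstimator nx ny X Y, K.UniformlyBoundedErrors A C ch := by
  obtain ⟨σ⟩ := UnitCircleSplitting.nonempty A
  obtain ⟨N, G, hG⟩ := hobs.exists_leftInverse_outputMap
  rw [σ.linEntropy_eq] at hlt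
  obtain ⟨γ, hγ, m, F, hF, hcard⟩ :=
    FiniteStateChannel.exists_isZeroErrorCode_of_logb_lt hq σ.one_le_norm_det_unstable hlt
  have hblocks : Tendsto (· * (m + 1)) atTop atTop :=
    tendsto_id.atTop_mul_const' m.succ_pos
  obtain ⟨j, ⟨T, hT, hTγ⟩, hj⟩ := ((hblocks.eventually
    (eventually_exists_isHalfNet_mulVecCLM_pow σ.one_le_norm hγ)).and
      (eventually_gt_atTop 0)).exists
  have hM : Fintype.card (Option T) ≤ F.card ^ j := by
    rw [mul_comm j, pow_mul, hcard] at hTγ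
    rw [Fintype.card_option, Fintype.card_coe]
    exact_mod_cast hTγ
  obtain ⟨w, hw⟩ := hF.exists_isZeroErrorEncoding hM
  have : NeZero (j * (m + 1)) := ⟨(Nat.mul_pos hj m.succ_pos).ne'⟩
  exact σ.exists_uniformlyBoundedErrors hG hT hw

end Sufficiency

end BoundedEstimation

theorem theorem2_general {nx ny : ℕ} {X Y S : Type*} [Fintype X] [Nonempty S]
    (A : Matrix (Fin nx) (Fin nx) ℝ) (C : Matrix (Fin ny) (Fin nx) ℝ) (hobs : IsObservable C A)
    (ch : FiniteStateChannel X Y S) (hq : 1 < Fintype.card X) :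
    ((∃ K : CoderEstimator nx ny X Y, K.UniformlyBoundedErrors A C ch) →
        linEntropy (Fintype.card X) A ≤ ch.zeroErrorCapacity) ∧
      (linEntropy (Fintype.card X) A < ch.zeroErrorCapacity →
        ∃ K : CoderEstimator nx ny X Y, K.UniformlyBoundedErrors A C ch) :=
  ⟨fun ⟨_, hK⟩ => hK.linEntropy_le hq,
    fun hlt => exists_uniformlyBoundedErrors_of_linEntropy_lt hq hobs hlt⟩

theorem theorem2 {nx ny : ℕ} {X Y S : Type*} [Fintype X] [Finite S] [Nonempty S]
    (A : Matrix (Fin nx) (Fin nx) ℝ) (C : Matrix (Fin ny) (Fin nx) ℝ)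
    (hobs : IsObservable C A)
    (hunstable : ∃ z ∈ BoundedEstimation.eigenvalues A, 1 < ‖z‖)
    (ch : FiniteStateChannel X Y S) (hC₀ : 0 < ch.zeroErrorCapacity) :
    ((∃ K : CoderEstimator nx ny X Y, K.UniformlyBoundedErrors A C ch) →
        linEntropy (Fintype.card X) A ≤ ch.zeroErrorCapacity) ∧
      (linEntropy (Fintype.card X) A < ch.zeroErrorCapacity →
        ∃ K : CoderEstimator nx ny X Y, K.UniformlyBoundedErrors A C ch) :=
  theorem2_general A C hobs ch (FiniteStateChannel.one_lt_card_of_zeroErrorCapacity_pos hC₀)
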